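/- Let $(P,\{\cdot,\cdot\})$ be a (Hausdorff, finite-dimensional, smooth) Poisson manifold, $H\in C^\infty(P)$, and let $X_H$ be the Hamiltonian vector field, $X_H[F]=\{F,H\}$ for all $F\in C^\infty(P)$. Let $\mathcal E_z=\{X_G(z)\mid G\in C^\infty(P)\}\subset T_zP$ be the characteristic distribution; its maximal connected integral manifolds are the symplectic leaves, so that $T_z\mathcal L=\mathcal E_z$ for $z$ in a leaf $\mathcal L$. A point is regular if the leaves through all nearby points have the same dimension (that is, $\dim\mathcal E_w$ is constant for $w$ near the point), and a leaf is regular if all its points are regular. Let $z_e$ be an equilibrium of $X_H$ ($X_H(z_e)=0$) that lies on a regular symplectic leaf $\mathcal L$, and let $L:T_{z_e}P\to T_{z_e}P$, $L(v)=\frac{d}{dt}\big|_{t=0}T_{z_e}\Phi_t(v)$, be the linearization of $X_H$ at $z_e$, where $\Phi_t$ is the local flow of $X_H$. A Darboux–Weinstein chart around $z_e$ is a chart centred at $z_e$ with coordinates $(\mathbf x,\mathbf z)$, $\mathbf x=(q^1,\dots,q^n,p_1,\dots,p_n)$, $\mathbf z=(z^1,\dots,z^r)$, in which $\{q^i,q^j\}=\{p_i,p_j\}=\{q^i,z^k\}=\{p_i,z^k\}=0$,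 $\{q^i,p_j\}=\delta^i_j$, and $\{z^k,z^l\}=\mathcal R^{kl}(\mathbf z)$ depends only on $\mathbf z$ and vanishes at $\mathbf z=0$. With $J=\begin{pmatrix}0&I_n\\-I_n&0\end{pmatrix}$ put $$\mathcal S^i_j=\sum_{p=1}^{2n}J^{ip}\frac{\partial^2H}{\partial x^p\partial x^j}(0,0),\quad \mathcal Q^i_l=\sum_{p=1}^{2n}J^{ip}\frac{\partial^2H}{\partial x^p\partial z^l}(0,0),\quad \mathcal P^k_l=\sum_{p=1}^{r}\frac{\partial\mathcal R^{kp}}{\partial z^l}(0)\frac{\partial H}{\partial z^p}(0,0).$$ Then: 1. In every Darboux–Weinstein chart around $z_e$ the matrix of $L$ is $\begin{pmatrix}\mathcal S&\mathcal Q\\0&\mathcal P\end{pmatrix}$, and $\mathcal P=0$. 2. If $u\in T_{z_e}P$ satisfies $Lu=\lambda u$ for some real $\lambda\neq0$, then $u\in T_{z_e}\mathcal L$. Likewise, if $u\in\mathbb C\otimes T_{z_e}P$ satisfies $Lu=\lambda u$ for some complex $\lambda\ne0$, then $u\in\mathbb C\otimes T_{z_e}\mathcal L$. In particular the unstable directions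 of $L$ (the real vectors in the sum of the generalized eigenspaces of the complexification of $L$ for the eigenvalues with positive real part) are tangent to $\mathcal L$. 3. Consider a Darboux–Weinstein chart around $z_e$, let $\lambda_1,\dots,\lambda_{2n}\in\mathbb C$ be the eigenvalues of $\mathcal S$ counted with algebraic multiplicity, and let $v_1,\dots,v_r$ be a basis of $\mathbb C^r$ consisting of eigenvectors of $\mathcal P$ such that for every $j$ the equation $\mathcal S w=\mathcal Q v_j$ has a solution $w\in\mathbb C^{2n}$. Then the eigenvalues of $L$, counted with algebraic multiplicity, are $\lambda_1,\dots,\lambda_{2n}$ and $r$ times $0$; in particular, $0$ is the only eigenvalue of $L$ in addition to $\lambda_1,\dots,\lambda_{2n}$ (and it is an eigenvalue if $r>0$). -/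

import Mathlib

open scoped Manifold ContDiff Matrix TensorProduct

universe u v

namespace PoissonLin

/-! ### Auxiliary facts: point derivations are tangent vectors -/

section aux

open Set Filter Topology MeasureTheory

/-- Smoothness of `y ↦ ∫₀¹ K (y, t) dt`. -/
theorem parametricIntegral_contDiff_nat {E : Type} [NormedAddCommGroup E] [NormedSpace ℝ E]
    [FiniteDimensional ℝ E] (n : ℕ) :
    ∀ {G : Type} [NormedAddCommGroup G] [NormedSpace ℝ G] [CompleteSpace G] (K : E × ℝ → G),
      ContDiff ℝ ∞ K → ContDiff ℝ n (fun y => ∫ t in (0:ℝ)..1, K (y, t)) := by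
  induction n with
  | zero =>
    intro G _ _ _ K hK
    simp only [Nat.cast_zero, contDiff_zero]
    exact intervalIntegral.continuous_parametric_intervalIntegral_of_continuous' (by simpa [Function.uncurry_def] using hK.continuous) 0 1
  | succ n ih =>
    intro G _ _ _ K hK
    have hd : Differentiable ℝ K := hK.differentiable (by simp)
    let K' : E × ℝ → (E →L[ℝ] G) := fun p => (fderiv ℝ K p).comp (ContinuousLinearMap.inl ℝ E ℝ)
    have hK' : ContDiff ℝ ∞ K' := by
      have h1 : ContDiff ℝ ∞ (fderiv ℝ K) := hK.fderiv_right (by simp)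
      exact h1.clm_comp contDiff_const
    have hder : ∀ y t, HasFDerivAt (fun y => K (y, t)) (K' (y, t)) y := by
      intro y t
      exact (hd (y, t)).hasFDerivAt.comp y (hasFDerivAt_prodMk_left y t)
    rw [Nat.cast_succ, contDiff_succ_iff_hasFDerivAt]
    refine ⟨fun y => ∫ t in (0:ℝ)..1, K' (y, t), ih K' hK', fun y => ?_⟩
    obtain ⟨C, hC⟩ := ((isCompact_closedBall y 1).prod (isCompact_Icc (a := (0:ℝ)) (b := 1))).exists_bound_of_continuousOn hK'.continuous.continuousOn
    refine intervalIntegral.hasFDerivAt_integral_of_dominated_of_fderiv_le (F := fun y t => K (y, t)) (F' := fun y t => K' (y, t))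
      (bound := fun _ => C) (Metric.closedBall_mem_nhds y one_pos) ?_ ?_ ?_ ?_ ?_ ?_
    · exact Eventually.of_forall fun x => (hK.continuous.comp (by fun_prop)).aestronglyMeasurable
    · exact (hK.continuous.comp (by fun_prop)).intervalIntegrable _ _
    · exact (hK'.continuous.comp (by fun_prop)).aestronglyMeasurable
    · refine Eventually.of_forall fun t ht x hx => hC (x, t) ⟨hx, ?_⟩
      rw [uIoc_of_le zero_le_one] at ht
      exact ⟨ht.1.le, ht.2⟩
    · simp
    · exact Eventually.of_forall fun t ht x hx => hder x t

/-- Hadamard's lemma. -/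
theorem hadamard_lemma {m : ℕ} (f : EuclideanSpace ℝ (Fin m) → ℝ) (hf : ContDiff ℝ ∞ f)
    (y₀ : EuclideanSpace ℝ (Fin m)) :
    ∃ g : Fin m → EuclideanSpace ℝ (Fin m) → ℝ, (∀ a, ContDiff ℝ ∞ (g a)) ∧
      (∀ a, g a y₀ = fderiv ℝ f y₀ (EuclideanSpace.single a 1)) ∧
      ∀ y, f y = f y₀ + ∑ a, (y a - y₀ a) * g a y := by
  have hf' : ContDiff ℝ ∞ (fderiv ℝ f) := hf.fderiv_right (by simp)
  have hd : Differentiable ℝ f := hf.differentiable (by simp)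
  have hK : ∀ a : Fin m, ContDiff ℝ ∞ (fun p : EuclideanSpace ℝ (Fin m) × ℝ =>
      fderiv ℝ f (y₀ + p.2 • (p.1 - y₀)) (EuclideanSpace.single a 1)) := by
    intro a
    refine ContDiff.clm_apply (hf'.comp ?_) contDiff_const
    fun_prop
  refine ⟨fun a y => ∫ t in (0:ℝ)..1, fderiv ℝ f (y₀ + t • (y - y₀)) (EuclideanSpace.single a 1), ?_, ?_, ?_⟩
  · intro a
    rw [contDiff_infty]
    exact fun n => parametricIntegral_contDiff_nat n _ (hK a)
  · intro a
    simp
  · intro y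
    have h1 : ∀ t ∈ uIcc (0:ℝ) 1, HasDerivAt (fun t : ℝ => f (y₀ + t • (y - y₀)))
        (fderiv ℝ f (y₀ + t • (y - y₀)) (y - y₀)) t := by
      intro t _
      have h2 : HasDerivAt (fun t : ℝ => y₀ + t • (y - y₀)) (y - y₀) t := by
        simpa using ((hasDerivAt_id t).smul_const (y - y₀)).const_add y₀
      exact (hd _).hasFDerivAt.comp_hasDerivAt t h2
    have hc : ∀ v, Continuous fun t : ℝ => fderiv ℝ f (y₀ + t • (y - y₀)) v := fun v =>
      (hf'.continuous.comp (by fun_prop)).clm_apply continuous_const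
    have h3 := intervalIntegral.integral_eq_sub_of_hasDerivAt h1 ((hc _).intervalIntegrable _ _)
    have h4 : y - y₀ = ∑ a, (y a - y₀ a) • EuclideanSpace.single a (1:ℝ) := by
      ext i
      simp [Finset.sum_apply, Pi.single_apply]
    have h5 : (∫ t in (0:ℝ)..1, fderiv ℝ f (y₀ + t • (y - y₀)) (y - y₀)) =
        ∑ a, (y a - y₀ a) * ∫ t in (0:ℝ)..1, fderiv ℝ f (y₀ + t • (y - y₀)) (EuclideanSpace.single a 1) := by
      simp_rw [← intervalIntegral.integral_const_mul]
      rw [← intervalIntegral.integral_finsetSum]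
      · refine intervalIntegral.integral_congr fun t _ => ?_
        conv_lhs => rw [h4]
        simp only [map_sum, map_smul, smul_eq_mul]
        rw [← h4]
      · exact fun a _ => ((hc _).const_mul _ |>.intervalIntegrable _ _) 
    rw [← h5, h3]
    simp

section derivations

variable {m : ℕ} {P : Type u} [TopologicalSpace P] [T2Space P]
  [ChartedSpace (EuclideanSpace ℝ (Fin m)) P] [IsManifold (𝓡 m) ∞ P]

/-- A point derivation of `C^∞(P)` only depends on germs. -/
theorem derivation_congr (D : C^∞⟮𝓡 m, P; ℝ⟯ →ₗ[ℝ] ℝ) (z : P)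
    (hD : ∀ F G, D (F * G) = F z * D G + D F * G z) {F G : C^∞⟮𝓡 m, P; ℝ⟯}
    (h : (F : P → ℝ) =ᶠ[𝓝 z] G) : D F = D G := by
  have key : ∀ K : C^∞⟮𝓡 m, P; ℝ⟯, (K : P → ℝ) =ᶠ[𝓝 z] 0 → D K = 0 := by
    intro K hK
    obtain ⟨ψ, -, hψ⟩ := (SmoothBumpFunction.nhds_basis_support (I := 𝓡 m) hK).mem_iff.1 hK
    let Ψ : C^∞⟮𝓡 m, P; ℝ⟯ := ⟨ψ, ψ.contMDiff⟩
    have h0 : Ψ * K = 0 := by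
      ext w
      by_cases hw : w ∈ Function.support ψ
      · have : K w = 0 := hψ hw
        simp [this]
      · have : ψ w = 0 := by simpa using hw
        change ψ w * K w = 0
        simp [this]
    have h1 := hD Ψ K
    have h2 : Ψ z = 1 := ψ.eq_one
    have h3 : K z = 0 := hK.self_of_nhds
    rw [h0, h2, h3] at h1
    simpa using h1.symm
  have := key (F - G) (by
    filter_upwards [h] with w hw
    simp [hw])
  rw [map_sub] at this
  linarith

/-- A point derivation kills constants. -/
theorem derivation_const (D : C^∞⟮𝓡 m, P; ℝ⟯ →ₗ[ℝ] ℝ) (z : P)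
    (hD : ∀ F G, D (F * G) = F z * D G + D F * G z) (c : ℝ) :
    D (c • (1 : C^∞⟮𝓡 m, P; ℝ⟯)) = 0 := by
  have h := hD 1 1
  have h1 : (1 : C^∞⟮𝓡 m, P; ℝ⟯) z = 1 := rfl
  rw [mul_one, h1] at h
  rw [map_smul]
  have : D 1 = 0 := by linarith
  simp [this]

/-- Every function that is smooth near `z` has the germ of a global smooth function. -/
theorem exists_extension (z : P) (f : P → ℝ) {s : Set P} (hs : s ∈ 𝓝 z)
    (hf : ContMDiffOn (𝓡 m) 𝓘(ℝ, ℝ) ∞ f s) :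
    ∃ F : C^∞⟮𝓡 m, P; ℝ⟯, (F : P → ℝ) =ᶠ[𝓝 z] f := by
  obtain ⟨ψ, -, hψ⟩ := (SmoothBumpFunction.nhds_basis_tsupport (I := 𝓡 m) z).mem_iff.1
    (interior_mem_nhds.2 hs)
  have hsm : ContMDiff (𝓡 m) 𝓘(ℝ, ℝ) ∞ (fun w => ψ w * f w) := by
    refine contMDiff_of_tsupport fun w hw => ?_
    have hw' : w ∈ tsupport ψ := closure_mono (Function.support_mul_subset_left _ _) hw
    have : s ∈ 𝓝 w := mem_interior_iff_mem_nhds.1 (hψ hw')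
    exact ψ.contMDiffAt.mul (hf.contMDiffAt this)
  refine ⟨⟨_, hsm⟩, ?_⟩
  filter_upwards [ψ.eventuallyEq_one] with w hw
  change ψ w * f w = f w
  simp [hw]

/-- Every point derivation of `C^∞(P)` is the derivative along a tangent vector. -/
theorem exists_tangent_of_derivation (D : C^∞⟮𝓡 m, P; ℝ⟯ →ₗ[ℝ] ℝ) (z : P)
    (hD : ∀ F G, D (F * G) = F z * D G + D F * G z) :
    ∃ v : TangentSpace (𝓡 m) z, ∀ F : C^∞⟮𝓡 m, P; ℝ⟯,
      (mfderiv (𝓡 m) 𝓘(ℝ, ℝ) F z : TangentSpace (𝓡 m) z → ℝ) v = D F := by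
  set φ := chartAt (EuclideanSpace ℝ (Fin m)) z with hφ
  have hφs : ContMDiffOn (𝓡 m) (𝓡 m) ∞ φ φ.source := contMDiffOn_chart
  have hsrc : φ.source ∈ 𝓝 z := chart_source_mem_nhds _ z
  have hY : ∀ a : Fin m, ∃ Y : C^∞⟮𝓡 m, P; ℝ⟯, (Y : P → ℝ) =ᶠ[𝓝 z] fun w => φ w a - φ z a := by
    intro a
    refine exists_extension z _ hsrc ?_
    have : ContMDiff (𝓡 m) 𝓘(ℝ, ℝ) ∞ (fun y : EuclideanSpace ℝ (Fin m) => y a - φ z a) := by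
      apply ContDiff.contMDiff
      fun_prop
    exact this.comp_contMDiffOn hφs
  choose Y hY using hY
  refine ⟨(WithLp.toLp 2 fun a => D (Y a) : EuclideanSpace ℝ (Fin m)), fun F => ?_⟩
  have hsymm : ContMDiffOn (𝓡 m) (𝓡 m) ∞ φ.symm φ.target := contMDiffOn_chart_symm
  have htgt : φ.target ∈ 𝓝 (φ z) := chart_target_mem_nhds _ z
  obtain ⟨f', hf'⟩ := exists_extension (m := m) (P := EuclideanSpace ℝ (Fin m)) (φ z) (F ∘ φ.symm) htgt
    (F.contMDiff.comp_contMDiffOn hsymm)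
  have hfs : ContDiff ℝ ∞ (f' : EuclideanSpace ℝ (Fin m) → ℝ) := f'.contMDiff.contDiff
  obtain ⟨g, hg, hg0, hfg⟩ := hadamard_lemma f' hfs (φ z)
  have hG : ∀ a : Fin m, ∃ G : C^∞⟮𝓡 m, P; ℝ⟯, (G : P → ℝ) =ᶠ[𝓝 z] fun w => g a (φ w) := fun a =>
    exists_extension z _ hsrc ((hg a).contMDiff.comp_contMDiffOn hφs)
  choose G hG using hG
  have hcont : Tendsto φ (𝓝 z) (𝓝 (φ z)) := φ.continuousAt (mem_chart_source _ z)
  have hFeq : (F : P → ℝ) =ᶠ[𝓝 z] (F z • (1 : C^∞⟮𝓡 m, P; ℝ⟯) + ∑ a, Y a * G a : C^∞⟮𝓡 m, P; ℝ⟯) := by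
    have hall : ∀ᶠ w in 𝓝 z, ∀ a, Y a w = φ w a - φ z a ∧ G a w = g a (φ w) :=
      eventually_all.2 fun a => (hY a).and (hG a)
    filter_upwards [hall, hcont.eventually hf', hsrc] with w hw hw2 hw3
    have h0 : f' (φ z) = F z := by
      rw [hf'.self_of_nhds]; simp [hφ]
    have h1 : f' (φ w) = F w := by
      rw [hw2]; simp [φ.left_inv hw3]
    rw [← h1, hfg (φ w), h0]
    have hsum : (∑ a, Y a * G a : C^∞⟮𝓡 m, P; ℝ⟯) w = ∑ a, Y a w * G a w := by
      have := map_sum (ContMDiffMap.evalRingHom w :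
        C^∞⟮𝓡 m, P; ℝ⟯ →+* ℝ) (fun a => Y a * G a) Finset.univ
      exact this
    change _ = F z * 1 + (∑ a, Y a * G a : C^∞⟮𝓡 m, P; ℝ⟯) w
    rw [hsum]
    simp [hw]
  have hDF : D F = ∑ a, D (Y a) * fderiv ℝ f' (φ z) (EuclideanSpace.single a 1) := by
    rw [derivation_congr D z hD hFeq, map_add, derivation_const D z hD, map_sum, zero_add]
    refine Finset.sum_congr rfl fun a _ => ?_
    rw [hD, (hY a).self_of_nhds, (hG a).self_of_nhds, ← hg0]
    simp
  have hmf : (mfderiv (𝓡 m) 𝓘(ℝ, ℝ) F z : EuclideanSpace ℝ (Fin m) →L[ℝ] ℝ) = fderiv ℝ f' (φ z) := by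
    have hmd : MDifferentiableAt (𝓡 m) 𝓘(ℝ, ℝ) F z := F.contMDiff.mdifferentiableAt (by simp)
    rw [hmd.mfderiv]
    simp only [mfld_simps, fderivWithin_univ]
    exact (Filter.EventuallyEq.fderiv_eq hf').symm
  rw [hDF]
  change (mfderiv (𝓡 m) 𝓘(ℝ, ℝ) F z : EuclideanSpace ℝ (Fin m) →L[ℝ] ℝ) _ = _
  have : (WithLp.toLp 2 fun a => D (Y a) : EuclideanSpace ℝ (Fin m)) = ∑ a, D (Y a) • EuclideanSpace.single a (1:ℝ) := by
    ext i
    simp [Pi.single_apply]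
  rw [this, hmf]
  exact (map_sum (fderiv ℝ f' (φ z)) _ _).trans (by simp)

end derivations

end aux

/-! ### Poisson manifolds -/

/-- A Poisson structure on a smooth `m`-dimensional manifold `P`: a Lie bracket on `C^∞(P)` that is
a derivation in each entry. (The derivation property is stated in the first entry; the one in the
second entry follows by antisymmetry.) -/
structure PoissonStructure (m : ℕ) (P : Type u) [TopologicalSpace P]
    [ChartedSpace (EuclideanSpace ℝ (Fin m)) P] where
  /-- the Poisson bracket `{F, G}` -/
  bracket : C^∞⟮𝓡 m, P; ℝ⟯ →ₗ[ℝ] C^∞⟮𝓡 m, P; ℝ⟯ →ₗ[ℝ] C^∞⟮𝓡 m, P; ℝ⟯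
  bracket_self : ∀ F, bracket F F = 0
  jacobi : ∀ F G K,
    bracket F (bracket G K) + bracket G (bracket K F) + bracket K (bracket F G) = 0
  leibniz : ∀ F G K, bracket (F * G) K = F * bracket G K + bracket F K * G

section Defs

variable {m : ℕ} {P : Type u} [TopologicalSpace P] [ChartedSpace (EuclideanSpace ℝ (Fin m)) P]

/-- The differential `dF(z)` of a smooth function, as a covector at `z`. -/
noncomputable def differential (F : C^∞⟮𝓡 m, P; ℝ⟯) (z : P) :
    TangentSpace (𝓡 m) z →L[ℝ] ℝ :=
  mfderiv (𝓡 m) 𝓘(ℝ, ℝ) F z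

/-- Tangent vectors are determined by their action on global smooth functions. -/
theorem tangent_ext [T2Space P] [IsManifold (𝓡 m) ∞ P] {z : P} {v w : TangentSpace (𝓡 m) z}
    (h : ∀ F : C^∞⟮𝓡 m, P; ℝ⟯, differential F z v = differential F z w) : v = w := by
  set φ := chartAt (EuclideanSpace ℝ (Fin m)) z with hφ
  have hφs : ContMDiffOn (𝓡 m) (𝓡 m) ∞ φ φ.source := contMDiffOn_chart
  have hmd : MDifferentiableAt (𝓡 m) (𝓡 m) φ z :=
    (hφs.contMDiffAt (chart_source_mem_nhds _ z)).mdifferentiableAt (by simp)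
  have key : ∀ a : Fin m, (id v : EuclideanSpace ℝ (Fin m)) a =
      (id w : EuclideanSpace ℝ (Fin m)) a := by
    intro a
    have hsm : ContMDiff (𝓡 m) 𝓘(ℝ, ℝ) ∞ (fun y : EuclideanSpace ℝ (Fin m) => y a) := by
      apply ContDiff.contMDiff
      fun_prop
    obtain ⟨Y, hY⟩ := exists_extension z _ (chart_source_mem_nhds _ z) (hsm.comp_contMDiffOn hφs)
    have hd : (mfderiv (𝓡 m) 𝓘(ℝ, ℝ) Y z : EuclideanSpace ℝ (Fin m) →L[ℝ] ℝ) =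
        EuclideanSpace.proj a := by
      have hYd : MDifferentiableAt (𝓡 m) 𝓘(ℝ, ℝ) Y z := Y.contMDiff.mdifferentiableAt (by simp)
      rw [hYd.mfderiv]
      simp only [mfld_simps, fderivWithin_univ]
      have hcont : Filter.Tendsto φ.symm (nhds (φ z)) (nhds z) := by
        have := φ.symm.continuousAt (x := φ z) (by simp [hφ])
        rwa [ContinuousAt, φ.left_inv (mem_chart_source _ z)] at this
      have : (Y : P → ℝ) ∘ φ.symm =ᶠ[nhds (φ z)]
          (EuclideanSpace.proj a : EuclideanSpace ℝ (Fin m) →L[ℝ] ℝ) := by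
        filter_upwards [hcont.eventually hY, chart_target_mem_nhds _ z] with y hy hyt
        simp only [Function.comp_apply, hy]
        rw [φ.right_inv hyt]
        rfl
      exact this.fderiv_eq.trans (ContinuousLinearMap.fderiv _)
    have := h Y
    change (mfderiv (𝓡 m) 𝓘(ℝ, ℝ) Y z : EuclideanSpace ℝ (Fin m) →L[ℝ] ℝ) v =
      (mfderiv (𝓡 m) 𝓘(ℝ, ℝ) Y z : EuclideanSpace ℝ (Fin m) →L[ℝ] ℝ) w at this
    rw [hd] at this
    exact this
  have h2 : (id v : EuclideanSpace ℝ (Fin m)) = (id w : EuclideanSpace ℝ (Fin m)) := PiLp.ext key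
  exact h2

/-- The tangent space at `ι x` of the immersed submanifold `ι : N → P`. -/
noncomputable def immersedTangentSpace (m k : ℕ) {P : Type u} [TopologicalSpace P]
    [ChartedSpace (EuclideanSpace ℝ (Fin m)) P] {N : Type v} [TopologicalSpace N]
    [ChartedSpace (EuclideanSpace ℝ (Fin k)) N] (ι : N → P) (x : N) :
    Submodule ℝ (TangentSpace (𝓡 m) (ι x)) :=
  LinearMap.range (mfderiv (𝓡 k) (𝓡 m) ι x).toLinearMap

namespace PoissonStructure

variable (π : PoissonStructure m P)

theorem exists_hamiltonianVector [T2Space P] [IsManifold (𝓡 m) ∞ P] (H : C^∞⟮𝓡 m, P; ℝ⟯) (z : P) :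
    ∃ v : TangentSpace (𝓡 m) z, ∀ F : C^∞⟮𝓡 m, P; ℝ⟯, differential F z v = π.bracket F H z :=
  exists_tangent_of_derivation
    { toFun := fun F => π.bracket F H z
      map_add' := fun F G => by rw [map_add]; rfl
      map_smul' := fun c F => by rw [map_smul]; rfl } z
    (fun F G => by
      change π.bracket (F * G) H z = F z * π.bracket G H z + π.bracket F H z * G z
      rw [π.leibniz]; rfl)

variable [T2Space P] [IsManifold (𝓡 m) ∞ P]

/-- The Hamiltonian vector field `X_H`, determined by `X_H[F] = {F, H}` for all `F`. -/
noncomputable def hamiltonianVectorField (H : C^∞⟮𝓡 m, P; ℝ⟯) (z : P) : TangentSpace (𝓡 m) z :=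
  (π.exists_hamiltonianVector H z).choose

theorem differential_hamiltonianVectorField (F H : C^∞⟮𝓡 m, P; ℝ⟯) (z : P) :
    differential F z (π.hamiltonianVectorField H z) = π.bracket F H z :=
  (π.exists_hamiltonianVector H z).choose_spec F

/-- The characteristic distribution: its fibre at `z` is `{X_H(z) | H ∈ C^∞(P)}`. -/
noncomputable def characteristicSpace (z : P) : Submodule ℝ (TangentSpace (𝓡 m) z) where
  carrier := Set.range fun H => π.hamiltonianVectorField H z
  add_mem' := by
    rintro _ _ ⟨H, rfl⟩ ⟨K, rfl⟩
    refine ⟨H + K, tangent_ext fun F => ?_⟩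
    simp only [map_add, differential_hamiltonianVectorField]
    rfl
  zero_mem' := by
    refine ⟨0, tangent_ext fun F => ?_⟩
    simp only [map_zero, differential_hamiltonianVectorField]
    rfl
  smul_mem' := by
    rintro c _ ⟨H, rfl⟩
    refine ⟨c • H, tangent_ext fun F => ?_⟩
    simp only [map_smul, differential_hamiltonianVectorField]
    rfl

/-- A point is regular if all symplectic leaves near it have the same dimension; the dimension of
the leaf through `w` is the dimension of the fibre at `w` of the characteristic distribution. -/
def IsRegularPoint (z : P) : Prop :=
  ∃ d : ℕ, ∀ᶠ w in nhds z, Module.finrank ℝ (π.characteristicSpace w) = d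

/-- `ι : N → P` is an (injectively immersed) integral manifold of the characteristic
distribution. -/
structure IsIntegralManifold (k : ℕ) {N : Type v} [TopologicalSpace N]
    [ChartedSpace (EuclideanSpace ℝ (Fin k)) N] (ι : N → P) : Prop where
  smooth : ContMDiff (𝓡 k) (𝓡 m) ∞ ι
  injective : Function.Injective ι
  immersion : ∀ x, Function.Injective (mfderiv (𝓡 k) (𝓡 m) ι x)
  tangent_eq : ∀ x, immersedTangentSpace m k ι x = π.characteristicSpace (ι x)

/-- `ι : N → P` is a symplectic leaf: a maximal connected integral manifold of the characteristic
distribution. -/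
structure IsSymplecticLeaf (k : ℕ) {N : Type v} [TopologicalSpace N]
    [ChartedSpace (EuclideanSpace ℝ (Fin k)) N] (ι : N → P) : Prop
    extends π.IsIntegralManifold k ι where
  connected : ConnectedSpace N
  maximal : ∀ (k' : ℕ) (N' : Type u) [TopologicalSpace N']
    [ChartedSpace (EuclideanSpace ℝ (Fin k')) N'] [IsManifold (𝓡 k') ∞ N'] [ConnectedSpace N']
    (ι' : N' → P), π.IsIntegralManifold k' ι' → (Set.range ι' ∩ Set.range ι).Nonempty →
      Set.range ι' ⊆ Set.range ι

/-- A leaf is regular if it consists of regular points. -/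
def IsRegularLeaf {N : Type v} (ι : N → P) : Prop :=
  ∀ x, π.IsRegularPoint (ι x)

end PoissonStructure

/-! ### Linearization at an equilibrium -/

/-- `Φ t x` is a smooth local flow of the vector field `X` around the point `z`. -/
def IsLocalFlow (X : (w : P) → TangentSpace (𝓡 m) w) (z : P) (Φ : ℝ → P → P) : Prop :=
  ∃ ε > 0, ∃ U ∈ nhds z,
    ContMDiffOn (𝓘(ℝ, ℝ).prod (𝓡 m)) (𝓡 m) ∞ (fun p : ℝ × P => Φ p.1 p.2)
      (Set.Ioo (-ε) ε ×ˢ U) ∧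
    ∀ w ∈ U, Φ 0 w = w ∧ IsMIntegralCurveOn (fun t => Φ t w) X (Set.Ioo (-ε) ε)

/-- The linearization `L v = d/dt|₀ T_zΦ_t(v)` of a vector field with flow `Φ` at an equilibrium
`z`. Since `Φ t z = z`, every `T_zΦ_t` is an endomorphism of `T_zP`, whose underlying space is the
model space. -/
noncomputable def linearization (Φ : ℝ → P → P) (z : P) :
    TangentSpace (𝓡 m) z →L[ℝ] TangentSpace (𝓡 m) z :=
  deriv (fun t : ℝ => (mfderiv (𝓡 m) (𝓡 m) (Φ t) z :
    EuclideanSpace ℝ (Fin m) →L[ℝ] EuclideanSpace ℝ (Fin m))) 0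

/-- The real vectors in the unstable subspace of an endomorphism: the sum of the generalized
eigenspaces of the complexification for the eigenvalues with positive real part. -/
noncomputable def unstableSpace {V : Type*} [AddCommGroup V] [Module ℝ V] (L : V →ₗ[ℝ] V) : Set V :=
  {u | (1 : ℂ) ⊗ₜ[ℝ] u ∈ ⨆ μ : {μ : ℂ // 0 < μ.re},
    Module.End.maxGenEigenspace (L.baseChange ℂ : Module.End ℂ (ℂ ⊗[ℝ] V)) μ}

/-! ### Darboux-Weinstein coordinates -/

/-- The matrix `J`. -/
def symplecticJ (n : ℕ) : Matrix (Fin n ⊕ Fin n) (Fin n ⊕ Fin n) ℝ :=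
  Matrix.fromBlocks 0 1 (-1) 0

/-- `{f, g}(w) = c` for functions `f`, `g` that are smooth near `w`: the bracket is local, so it is
computed on arbitrary global functions with the same germs at `w`. -/
def PoissonStructure.HasLocalBracket (π : PoissonStructure m P) (f g : P → ℝ) (w : P) (c : ℝ) :
    Prop :=
  ∀ F G : C^∞⟮𝓡 m, P; ℝ⟯, (F : P → ℝ) =ᶠ[nhds w] f → (G : P → ℝ) =ᶠ[nhds w] g →
    π.bracket F G w = c

/-- A Darboux-Weinstein chart around `z₀`, with coordinates `((q, p), z)`, indexed by
`(Fin n ⊕ Fin n) ⊕ Fin r`. -/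
structure DarbouxWeinsteinChart (π : PoissonStructure m P) (z₀ : P) (n r : ℕ) where
  chart : OpenPartialHomeomorph P (EuclideanSpace ℝ (Fin m))
  mem_maximalAtlas : chart ∈ IsManifold.maximalAtlas (𝓡 m) ∞ P
  mem_source : z₀ ∈ chart.source
  map_base : chart z₀ = 0
  /-- the labelling of the `m = 2n + r` coordinates as `q`, `p`, and `z` -/
  index : (Fin n ⊕ Fin n) ⊕ Fin r ≃ Fin m
  /-- the matrix of the transverse Poisson tensor, `{z^k, z^l} = R^{kl}(z)` -/
  R : (Fin r → ℝ) → Matrix (Fin r) (Fin r) ℝ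
  R_zero : R 0 = 0
  /-- the relations `{q, q} = {p, p} = {q, z} = {p, z} = 0`, `{q^i, p_j} = δ^i_j`, and
  `{z^k, z^l} = R^{kl}(z)` on the domain of the chart -/
  bracket_coord : ∀ w ∈ chart.source, ∀ a b,
    π.HasLocalBracket (fun w' => chart w' (index a)) (fun w' => chart w' (index b)) w
      (Matrix.fromBlocks (symplecticJ n) 0 0
        (R fun k => chart w (index (Sum.inr k))) a b)

/-- The partial derivative `∂f/∂y^a`. -/
noncomputable def partialDeriv (a : Fin m) (f : EuclideanSpace ℝ (Fin m) → ℝ)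
    (y : EuclideanSpace ℝ (Fin m)) : ℝ :=
  fderiv ℝ f y (EuclideanSpace.single a 1)

namespace DarbouxWeinsteinChart

variable {π : PoissonStructure m P} {z₀ : P} {n r : ℕ} (c : DarbouxWeinsteinChart π z₀ n r)

/-- A function in the coordinates of the chart. -/
noncomputable def localRep (H : C^∞⟮𝓡 m, P; ℝ⟯) (y : EuclideanSpace ℝ (Fin m)) : ℝ :=
  H (c.chart.symm y)

/-- The block `S^i_j = ∑ₚ J^{ip} ∂²H/∂x^p∂x^j (0, 0)`. -/
noncomputable def blockS (H : C^∞⟮𝓡 m, P; ℝ⟯) : Matrix (Fin n ⊕ Fin n) (Fin n ⊕ Fin n) ℝ :=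
  Matrix.of fun i j => ∑ p, symplecticJ n i p *
    partialDeriv (c.index (Sum.inl p)) (partialDeriv (c.index (Sum.inl j)) (c.localRep H)) 0

/-- The block `Q^i_l = ∑ₚ J^{ip} ∂²H/∂x^p∂z^l (0, 0)`. -/
noncomputable def blockQ (H : C^∞⟮𝓡 m, P; ℝ⟯) : Matrix (Fin n ⊕ Fin n) (Fin r) ℝ :=
  Matrix.of fun i l => ∑ p, symplecticJ n i p *
    partialDeriv (c.index (Sum.inl p)) (partialDeriv (c.index (Sum.inr l)) (c.localRep H)) 0

/-- The transverse block `P^k_l = ∑ₚ ∂R^{kp}/∂z^l (0) ∂H/∂z^p (0, 0)`. -/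
noncomputable def blockP (H : C^∞⟮𝓡 m, P; ℝ⟯) : Matrix (Fin r) (Fin r) ℝ :=
  Matrix.of fun k l => ∑ p, fderiv ℝ (fun z => c.R z k p) 0 (Pi.single l 1) *
    partialDeriv (c.index (Sum.inr p)) (c.localRep H) 0

/-- The matrix, in the coordinates of the chart, of an endomorphism `L` of `T_{z₀}P`: its entry
`(a, b)` is `dy^a(L (∂/∂y^b))`. -/
noncomputable def coordMatrix (L : TangentSpace (𝓡 m) z₀ →L[ℝ] TangentSpace (𝓡 m) z₀) :
    Matrix ((Fin n ⊕ Fin n) ⊕ Fin r) ((Fin n ⊕ Fin n) ⊕ Fin r) ℝ :=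
  Matrix.of fun a b =>
    (EuclideanSpace.proj (c.index a) : EuclideanSpace ℝ (Fin m) →L[ℝ] ℝ)
      (mfderiv (𝓡 m) (𝓡 m) c.chart z₀ (L ((mfderiv (𝓡 m) (𝓡 m) c.chart.symm (c.chart z₀) :
          EuclideanSpace ℝ (Fin m) →L[ℝ] EuclideanSpace ℝ (Fin m))
        (EuclideanSpace.single (c.index b) 1))))

end DarbouxWeinsteinChart

/-- The eigenvalues in `ℂ` of a real square matrix, counted with algebraic multiplicity. -/
noncomputable def complexEigenvalues {α : Type*} [Fintype α] [DecidableEq α] (A : Matrix α α ℝ) :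
    Multiset ℂ :=
  (A.map (algebraMap ℝ ℂ)).charpoly.roots

end Defs

end PoissonLin

namespace PoissonLin

/-! ### Differentials of global functions, and covectors as differentials. -/

section DifferentialCalculus

variable {m : ℕ} {P : Type u} [TopologicalSpace P] [ChartedSpace (EuclideanSpace ℝ (Fin m)) P]

/-! The whole theorem rests on one fact: at a regular equilibrium `z`, the linearization `L` takes
values in the characteristic space `E_z`, the tangent space of the leaf.

Differentiating `X_H[F] = {F, H}` at a zero of `X_H` gives `dF ∘ L = d{F, H}` at `z`
(`PoissonStructure.differential_linearization`). It remains to show that a covector `dA(z)`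
annihilating `E_z` also annihilates the range of `L`, that is, `d{A, H}(z) = 0`. This is where
regularity enters (`PoissonStructure.differential_bracket_eq_zero`). Choose `G_j` whose Hamiltonian
vectors form a basis of `E_z`, and `F_i` whose differentials restrict to the dual basis. The matrix
`M = ({F_i, G_j})` is the identity at `z`, hence invertible nearby; as the rank is constant, the
`X_{G_j}` still span `E_w` for `w` near `z`, and so `{A, H} = ∑ {A, G_j} (M⁻¹)_{ji} {F_i, H}` near
`z`. Both outer factors vanish at `z`, because `X_A(z) = 0` and `X_H(z) = 0`, so every summand is
critical there.

Once the range of `L` lies in `E_z`, an eigenvector for `λ ≠ 0` is `λ⁻¹ L u`, hence tangent to the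
leaf; generalized eigenvectors follow by induction on the exponent, over `ℂ` by base change. In a
Darboux–Weinstein chart the differentials of the transverse coordinates kill `E_z`, so the lower
rows of the matrix of `L` vanish. Computing the same rows from `dz^k ∘ L = d{z^k, H}` gives `(0,
P)`, hence `P = 0`, and the characteristic polynomial of `L` is that of `S` times `X^r`. -/

instance finiteDimensional_tangentSpace (z : P) : FiniteDimensional ℝ (TangentSpace (𝓡 m) z) :=
  inferInstanceAs (FiniteDimensional ℝ (EuclideanSpace ℝ (Fin m)))

theorem hasMFDerivAt_differential (F : C^∞⟮𝓡 m, P; ℝ⟯) (z : P) :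
    HasMFDerivAt (𝓡 m) 𝓘(ℝ, ℝ) F z (differential F z) :=
  (F.contMDiff.mdifferentiableAt (by simp)).hasMFDerivAt

theorem differential_congr {F G : C^∞⟮𝓡 m, P; ℝ⟯} {z : P} (h : (F : P → ℝ) =ᶠ[nhds z] G) :
    differential F z = differential G z :=
  h.mfderiv_eq

theorem differential_add (F G : C^∞⟮𝓡 m, P; ℝ⟯) (z : P) :
    differential (F + G) z = differential F z + differential G z :=
  ((hasMFDerivAt_differential F z).add (hasMFDerivAt_differential G z)).mfderiv

theorem differential_mul (F G : C^∞⟮𝓡 m, P; ℝ⟯) (z : P) :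
    differential (F * G) z = F z • differential G z + G z • differential F z :=
  ((hasMFDerivAt_differential F z).mul (hasMFDerivAt_differential G z)).mfderiv

theorem differential_zero (z : P) : differential (0 : C^∞⟮𝓡 m, P; ℝ⟯) z = 0 := by
  have h := differential_add (0 : C^∞⟮𝓡 m, P; ℝ⟯) 0 z
  rw [add_zero] at h
  exact left_eq_add.1 h

theorem differential_sum {ι : Type*} (s : Finset ι) (F : ι → C^∞⟮𝓡 m, P; ℝ⟯) (z : P) :
    differential (∑ i ∈ s, F i) z = ∑ i ∈ s, differential (F i) z :=
  map_sum (⟨⟨fun F => differential F z, differential_zero z⟩, fun F G => differential_add F G z⟩ :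
    C^∞⟮𝓡 m, P; ℝ⟯ →+ (TangentSpace (𝓡 m) z →L[ℝ] ℝ)) F s

theorem differential_mul_eq_zero {F G : C^∞⟮𝓡 m, P; ℝ⟯} {z : P} (hF : F z = 0) (hG : G z = 0) :
    differential (F * G) z = 0 := by
  rw [differential_mul, hF, hG, zero_smul, zero_smul, add_zero]

theorem mdifferentiable_of_mem_maximalAtlas
    {e : OpenPartialHomeomorph P (EuclideanSpace ℝ (Fin m))}
    (he : e ∈ IsManifold.maximalAtlas (𝓡 m) ∞ P) :
    OpenPartialHomeomorph.MDifferentiable (𝓡 m) (𝓡 m) e :=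
  ⟨(contMDiffOn_of_mem_maximalAtlas he).mdifferentiableOn (by simp),
    (contMDiffOn_symm_of_mem_maximalAtlas he).mdifferentiableOn (by simp)⟩

/-- The differential of a function that is linear in a chart. -/
theorem differential_of_eventuallyEq_chart
    {e : OpenPartialHomeomorph P (EuclideanSpace ℝ (Fin m))}
    (he : e ∈ IsManifold.maximalAtlas (𝓡 m) ∞ P) (β : EuclideanSpace ℝ (Fin m) →L[ℝ] ℝ)
    {z : P} (hz : z ∈ e.source) {F : C^∞⟮𝓡 m, P; ℝ⟯}
    (hF : (F : P → ℝ) =ᶠ[nhds z] fun w => β (e w)) (v : TangentSpace (𝓡 m) z) :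
    differential F z v =
      β ((mfderiv (𝓡 m) (𝓡 m) e z : EuclideanSpace ℝ (Fin m) →L[ℝ] EuclideanSpace ℝ (Fin m)) v) := by
  have h1 := ((mdifferentiable_of_mem_maximalAtlas he).mdifferentiableAt hz).hasMFDerivAt
  have h2 : HasMFDerivAt (𝓡 m) 𝓘(ℝ, ℝ) β (e z) β := β.hasMFDerivAt
  have h3 := (h2.comp z h1).mfderiv
  have h4 : differential F z = mfderiv (𝓡 m) 𝓘(ℝ, ℝ) (β ∘ e) z := hF.mfderiv_eq
  rw [h4, h3]
  rfl

variable [T2Space P] [IsManifold (𝓡 m) ∞ P]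

theorem exists_eventuallyEq_chart
    {e : OpenPartialHomeomorph P (EuclideanSpace ℝ (Fin m))}
    (he : e ∈ IsManifold.maximalAtlas (𝓡 m) ∞ P) (β : EuclideanSpace ℝ (Fin m) →L[ℝ] ℝ)
    {z : P} (hz : z ∈ e.source) :
    ∃ F : C^∞⟮𝓡 m, P; ℝ⟯, (F : P → ℝ) =ᶠ[nhds z] fun w => β (e w) :=
  exists_extension z _ (e.open_source.mem_nhds hz)
    (β.contDiff.contMDiff.comp_contMDiffOn (contMDiffOn_of_mem_maximalAtlas he))

/-- Every covector is the differential of a function. -/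
theorem exists_differential_eq {z : P} (β : TangentSpace (𝓡 m) z →ₗ[ℝ] ℝ) :
    ∃ F : C^∞⟮𝓡 m, P; ℝ⟯, ∀ v, differential F z v = β v := by
  have he := IsManifold.chart_mem_maximalAtlas (I := 𝓡 m) (n := ∞) z
  have hz := mem_chart_source (EuclideanSpace ℝ (Fin m)) z
  set e := chartAt (EuclideanSpace ℝ (Fin m)) z
  -- The function is linear in the chart; precomposing `β` with the derivative of the inverse chart
  -- cancels the derivative of the chart.
  let A : EuclideanSpace ℝ (Fin m) →L[ℝ] EuclideanSpace ℝ (Fin m) :=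
    mfderiv (𝓡 m) (𝓡 m) e.symm (e z)
  let γ : EuclideanSpace ℝ (Fin m) →ₗ[ℝ] ℝ := β
  obtain ⟨F, hF⟩ := exists_eventuallyEq_chart he (γ.toContinuousLinearMap.comp A) hz
  refine ⟨F, fun v => ?_⟩
  rw [differential_of_eventuallyEq_chart he _ hz hF]
  exact congrArg β (DFunLike.congr_fun
    ((mdifferentiable_of_mem_maximalAtlas he).symm_comp_deriv hz) v)

end DifferentialCalculus

/-! ### Brackets near a regular point. -/

namespace PoissonStructure

variable {m : ℕ} {P : Type u} [TopologicalSpace P] [ChartedSpace (EuclideanSpace ℝ (Fin m)) P]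
  (π : PoissonStructure m P)

theorem bracket_antisymm (F G : C^∞⟮𝓡 m, P; ℝ⟯) : π.bracket F G = -π.bracket G F := by
  have h := π.bracket_self (F + G)
  simp only [map_add, LinearMap.add_apply, bracket_self, zero_add, add_zero] at h
  exact eq_neg_of_add_eq_zero_right h

variable [T2Space P] [IsManifold (𝓡 m) ∞ P]

theorem hamiltonianVectorField_mem (H : C^∞⟮𝓡 m, P; ℝ⟯) (z : P) :
    π.hamiltonianVectorField H z ∈ π.characteristicSpace z :=
  ⟨H, rfl⟩

/-- If the characteristic distribution has rank `d` at `w`, and the brackets of `F₁, …, F_d` with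
`G₁, …, G_d` form an invertible matrix `M` at `w`, then all brackets at `w` are determined
by those with the `Fᵢ` and `Gⱼ`. -/
theorem det_mul_bracket_eq {d : ℕ} (F G : Fin d → C^∞⟮𝓡 m, P; ℝ⟯) (A H : C^∞⟮𝓡 m, P; ℝ⟯) (w : P)
    (hd : Module.finrank ℝ (π.characteristicSpace w) = d)
    (hdet : (Matrix.of fun i j => π.bracket (F i) (G j) w).det ≠ 0) :
    (Matrix.of fun i j => π.bracket (F i) (G j) w).det * π.bracket A H w =
      ∑ j, ∑ i, π.bracket A (G j) w *
        ((Matrix.of fun i j => π.bracket (F i) (G j) w).adjugate j i * π.bracket (F i) H w) := by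
  set M := Matrix.of fun i j => π.bracket (F i) (G j) w with hM
  have hcomb : ∀ (c : Fin d → ℝ) (K : C^∞⟮𝓡 m, P; ℝ⟯),
      differential K w (∑ j, c j • π.hamiltonianVectorField (G j) w) =
        ∑ j, π.bracket K (G j) w * c j := by
    intro c K
    rw [map_sum]
    refine Finset.sum_congr rfl fun j _ => ?_
    rw [map_smul, differential_hamiltonianVectorField, smul_eq_mul, mul_comm]
  -- Pairing a linear relation with the `dF_i` puts its coefficients in the kernel of `M`.
  have hli : LinearIndependent ℝ fun j => π.hamiltonianVectorField (G j) w := by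
    rw [Fintype.linearIndependent_iff]
    intro c hc
    have : M *ᵥ c = 0 := by
      ext i
      have := hcomb c (F i)
      rw [hc, map_zero] at this
      exact this.symm
    exact congrFun (Matrix.eq_zero_of_mulVec_eq_zero hdet this)
  have hspan : Submodule.span ℝ (Set.range fun j => π.hamiltonianVectorField (G j) w) =
      π.characteristicSpace w := by
    refine Submodule.eq_of_le_of_finrank_eq ?_ ?_
    · rw [Submodule.span_le]
      rintro _ ⟨j, rfl⟩
      exact π.hamiltonianVectorField_mem _ _
    · rw [finrank_span_eq_card hli, hd, Fintype.card_fin]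
  have hmem : π.hamiltonianVectorField H w ∈
      Submodule.span ℝ (Set.range fun j => π.hamiltonianVectorField (G j) w) := by
    rw [hspan]; exact π.hamiltonianVectorField_mem _ _
  obtain ⟨c, hc⟩ := (Submodule.mem_span_range_iff_exists_fun ℝ).1 hmem
  have hbr : ∀ K, π.bracket K H w = ∑ j, π.bracket K (G j) w * c j := by
    intro K
    rw [← hcomb c K, hc, differential_hamiltonianVectorField]
  have hMc : (fun i => π.bracket (F i) H w) = M *ᵥ c := by
    ext i
    exact hbr (F i)
  -- Cramer's rule in place of the inverse: every term stays polynomial in brackets, which makes the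
  -- identity one between smooth functions.
  have hadj : M.adjugate *ᵥ (fun i => π.bracket (F i) H w) = M.det • c := by
    rw [hMc, Matrix.mulVec_mulVec, Matrix.adjugate_mul, Matrix.smul_mulVec, Matrix.one_mulVec]
  simp only [← Finset.mul_sum]
  have h2 : ∀ j, ∑ i, M.adjugate j i * π.bracket (F i) H w = M.det * c j := fun j =>
    congrFun hadj j
  simp only [h2]
  rw [hbr A, Finset.mul_sum]
  exact Finset.sum_congr rfl fun j _ => by ring

/-- At a regular point, the bracket of two functions whose Hamiltonian vector fields vanish there
is critical. -/
theorem differential_bracket_eq_zero {z : P} (hz : π.IsRegularPoint z) {A H : C^∞⟮𝓡 m, P; ℝ⟯}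
    (hA : ∀ G, π.bracket A G z = 0) (hH : ∀ F, π.bracket F H z = 0) :
    differential (π.bracket A H) z = 0 := by
  obtain ⟨d, hd⟩ := hz
  let b := Module.finBasisOfFinrankEq ℝ (π.characteristicSpace z) hd.self_of_nhds
  choose G hG using fun j => (b j).2
  -- Extend the dual basis of the characteristic space to covectors on the whole tangent space, and
  -- realize these as differentials.
  have hex : ∀ i, ∃ F : C^∞⟮𝓡 m, P; ℝ⟯, ∀ v : π.characteristicSpace z,
      differential F z v = b.coord i v := by
    intro i
    obtain ⟨β, hβ⟩ := LinearMap.exists_extend (b.coord i)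
    obtain ⟨F, hF⟩ := exists_differential_eq β
    exact ⟨F, fun v => (hF v).trans (DFunLike.congr_fun hβ v)⟩
  choose F hF using hex
  -- A matrix over the ring of smooth functions: its determinant and adjugate are then smooth, and
  -- evaluation at a point, being a ring homomorphism, commutes with both.
  let M : Matrix (Fin d) (Fin d) C^∞⟮𝓡 m, P; ℝ⟯ := Matrix.of fun i j => π.bracket (F i) (G j)
  let ev : P → C^∞⟮𝓡 m, P; ℝ⟯ →+* ℝ := fun w => ContMDiffMap.evalRingHom w
  have hMw : ∀ w, (ev w).mapMatrix M = Matrix.of fun i j => π.bracket (F i) (G j) w := fun w => rfl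
  have hdet : ∀ w, (Matrix.of fun i j => π.bracket (F i) (G j) w).det = M.det w := fun w => by
    rw [← hMw, ← RingHom.map_det]; rfl
  have hadj : ∀ w i j, (Matrix.of fun i j => π.bracket (F i) (G j) w).adjugate i j =
      M.adjugate i j w := fun w i j => by
    rw [← hMw, ← RingHom.map_adjugate]; rfl
  have hMz : M.det z = 1 := by
    have h1 : (Matrix.of fun i j => π.bracket (F i) (G j) z) = 1 := by
      ext i j
      rw [Matrix.of_apply, ← π.differential_hamiltonianVectorField]
      have h2 : π.hamiltonianVectorField (G j) z = b j := hG j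
      rw [h2, hF, Module.Basis.coord_apply, b.repr_self, Finsupp.single_apply, Matrix.one_apply]
      simp only [eq_comm]
    rw [← hdet, h1, Matrix.det_one]
  have hne : ∀ᶠ w in nhds z, M.det w ≠ 0 :=
    (M.det.contMDiff.continuous.continuousAt).eventually_ne (by rw [hMz]; exact one_ne_zero)
  have heq : (M.det * π.bracket A H : C^∞⟮𝓡 m, P; ℝ⟯) =ᶠ[nhds z]
      (∑ j, ∑ i, π.bracket A (G j) * (M.adjugate j i * π.bracket (F i) H) :
        C^∞⟮𝓡 m, P; ℝ⟯) := by
    filter_upwards [hd, hne] with w hw1 hw2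
    have h := π.det_mul_bracket_eq F G A H w hw1 (by rwa [hdet])
    simp only [hdet, hadj] at h
    have h' : ev w (M.det * π.bracket A H) =
        ev w (∑ j, ∑ i, π.bracket A (G j) * (M.adjugate j i * π.bracket (F i) H)) := by
      simp only [map_sum, map_mul]
      exact h
    exact h'
  have h1 := differential_congr heq
  -- The determinant is `1` and `{A, H}` is `0` at `z`, so the left side differentiates to `d{A,
  -- H}`.
  rw [differential_mul, hMz, hH A, one_smul, zero_smul, add_zero, differential_sum] at h1
  rw [h1]
  refine Finset.sum_eq_zero fun j _ => ?_
  rw [differential_sum]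
  refine Finset.sum_eq_zero fun i _ => differential_mul_eq_zero (hA _) ?_
  change M.adjugate j i z * π.bracket (F i) H z = 0
  rw [hH, mul_zero]

end PoissonStructure

end PoissonLin

namespace PoissonLin

/-! ### The linearization of a flow at an equilibrium. -/

section LocalFlow

variable {m : ℕ} {P : Type u} [TopologicalSpace P] [ChartedSpace (EuclideanSpace ℝ (Fin m)) P]

/-- Uniqueness of integral curves of a C¹ field, compared with the constant curve. That the flow
fixes `z` for small times is what lets its derivative at `z` be read in one chart on both sides. -/
theorem IsLocalFlow.eventually_eq_self [T2Space P] [IsManifold (𝓡 m) ∞ P]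
    {X : (w : P) → TangentSpace (𝓡 m) w} {z : P}
    {Φ : ℝ → P → P} (hΦ : IsLocalFlow X z Φ)
    (hX : ContMDiffAt (𝓡 m) (𝓡 m).tangent 1 (fun w => (⟨w, X w⟩ : TangentBundle (𝓡 m) P)) z)
    (hz : X z = 0) : ∀ᶠ t in nhds (0 : ℝ), Φ t z = z := by
  obtain ⟨ε, hε, U, hU, -, h⟩ := hΦ
  obtain ⟨h0, h1⟩ := h z (mem_of_mem_nhds hU)
  have : IsManifold (𝓡 m) 1 P := .of_le (n := ∞) (by simp)
  refine isMIntegralCurveAt_eventuallyEq_of_contMDiffAt_boundaryless (I := 𝓡 m) (v := X)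
    (γ := fun t => Φ t z) (γ' := fun _ => z) (t₀ := 0) ?_ ?_ ?_ h0
  · simpa only [h0] using hX
  · exact h1.isMIntegralCurveAt (Ioo_mem_nhds (by linarith) hε)
  · exact (isMIntegralCurve_const hz).isMIntegralCurveAt 0

/-- A flow read in the preferred chart at `z` is smooth. -/
theorem IsLocalFlow.contDiffAt [IsManifold (𝓡 m) ∞ P] {X : (w : P) → TangentSpace (𝓡 m) w} {z : P}
    {Φ : ℝ → P → P} (hΦ : IsLocalFlow X z Φ) :
    ContDiffAt ℝ ∞ (fun p : ℝ × EuclideanSpace ℝ (Fin m) =>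
      chartAt (EuclideanSpace ℝ (Fin m)) z
        (Φ p.1 ((chartAt (EuclideanSpace ℝ (Fin m)) z).symm p.2)))
      (0, chartAt (EuclideanSpace ℝ (Fin m)) z z) := by
  obtain ⟨ε, hε, U, hU, hs, h⟩ := hΦ
  set e := chartAt (EuclideanSpace ℝ (Fin m)) z with he
  have hez : z ∈ e.source := mem_chart_source _ z
  have hsymm : ContMDiffAt (𝓡 m) (𝓡 m) ∞ e.symm (e z) :=
    contMDiffOn_chart_symm.contMDiffAt (chart_target_mem_nhds _ z)
  have hchart : ContMDiffAt (𝓡 m) (𝓡 m) ∞ e z :=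
    contMDiffOn_chart.contMDiffAt (chart_source_mem_nhds _ z)
  have h1 : ContMDiffAt 𝓘(ℝ, ℝ × EuclideanSpace ℝ (Fin m)) (𝓘(ℝ, ℝ).prod (𝓡 m)) ∞
      (fun p : ℝ × EuclideanSpace ℝ (Fin m) => (p.1, e.symm p.2)) (0, e z) :=
    contDiff_fst.contMDiff.contMDiffAt.prodMk
      (ContMDiffAt.comp (x := ((0, e z) : ℝ × EuclideanSpace ℝ (Fin m))) (g := e.symm)
        (f := Prod.snd) hsymm contDiff_snd.contMDiff.contMDiffAt)
  have h2 : ContMDiffAt (𝓘(ℝ, ℝ).prod (𝓡 m)) (𝓡 m) ∞ (fun p : ℝ × P => Φ p.1 p.2) (0, z) :=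
    hs.contMDiffAt (prod_mem_nhds (Ioo_mem_nhds (by linarith) hε) hU)
  rw [← (h z (mem_of_mem_nhds hU)).1] at hchart
  have h3 := ContMDiffAt.comp (0, z) (g := e) hchart h2
  have h4 : (fun p : ℝ × EuclideanSpace ℝ (Fin m) => (p.1, e.symm p.2)) (0, e z) = (0, z) := by
    simp [e.left_inv hez]
  rw [← h4] at h3
  exact (h3.comp (0, e z) h1).contDiffAt

theorem IsLocalFlow.hasDerivAt_comp {X : (w : P) → TangentSpace (𝓡 m) w} {z : P}
    {Φ : ℝ → P → P} (hΦ : IsLocalFlow X z Φ) (F : C^∞⟮𝓡 m, P; ℝ⟯) :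
    ∀ᶠ w in nhds z, Φ 0 w = w ∧ ContinuousAt (fun t => Φ t w) 0 ∧
      HasDerivAt (fun t => F (Φ t w)) (differential F w (X w)) 0 := by
  obtain ⟨ε, hε, U, hU, hs, h⟩ := hΦ
  filter_upwards [hU] with w hw
  obtain ⟨h0, h1⟩ := h w hw
  have h2 := (h1 0 ⟨by linarith, hε⟩).hasMFDerivAt (Ioo_mem_nhds (by linarith) hε)
  refine ⟨h0, h2.continuousAt, ?_⟩
  let D : ℝ →L[ℝ] ℝ :=
    (differential F (Φ 0 w)).comp (ContinuousLinearMap.smulRight (1 : ℝ →L[ℝ] ℝ) (X (Φ 0 w)))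
  have h3 : HasFDerivAt (fun t => F (Φ t w)) D 0 :=
    hasMFDerivAt_iff_hasFDerivAt.1 ((hasMFDerivAt_differential F (Φ 0 w)).comp (0 : ℝ) h2)
  have h4 : D 1 = differential F (Φ 0 w) (X (Φ 0 w)) := by
    change differential F (Φ 0 w) ((1 : ℝ) • X (Φ 0 w)) = _
    rw [one_smul]
  -- `X (Φ 0 w)` and `X w` lie in different fibres, so the two base points are identified by
  -- substitution.
  have h5 : ∀ w', w' = w → differential F w' (X w') = differential F w (X w) := by
    rintro _ rfl; rfl
  rw [← h5 _ h0, ← h4]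
  exact h3.hasDerivAt

/-- The linearization at an equilibrium, read in the preferred chart at `z`. -/
theorem IsLocalFlow.linearization_apply [IsManifold (𝓡 m) ∞ P]
    {X : (w : P) → TangentSpace (𝓡 m) w} {z : P}
    {Φ : ℝ → P → P} (hΦ : IsLocalFlow X z Φ) (hfix : ∀ᶠ t in nhds (0 : ℝ), Φ t z = z)
    (v : EuclideanSpace ℝ (Fin m)) :
    linearization Φ z v = fderiv ℝ (fun y => fderiv ℝ
      (fun p : ℝ × EuclideanSpace ℝ (Fin m) => chartAt (EuclideanSpace ℝ (Fin m)) z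
        (Φ p.1 ((chartAt (EuclideanSpace ℝ (Fin m)) z).symm p.2))) (0, y) (1, 0))
      (chartAt (EuclideanSpace ℝ (Fin m)) z z) v := by
  have hf := hΦ.contDiffAt
  set e := chartAt (EuclideanSpace ℝ (Fin m)) z with he
  set f := fun p : ℝ × EuclideanSpace ℝ (Fin m) => e (Φ p.1 (e.symm p.2)) with hfdef
  have hf1 : ∀ᶠ p in nhds ((0 : ℝ), e z), DifferentiableAt ℝ f p :=
    ((hf.of_le (m := 1) (by simp)).eventually (by simp)).mono fun p hp =>
      hp.differentiableAt (by simp)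
  have hf' : DifferentiableAt ℝ (fderiv ℝ f) (0, e z) :=
    (hf.fderiv_right (m := 1) (by norm_cast)).differentiableAt (by simp)
  -- For small `t` the point `Φ t z` is `z`, so the manifold derivative uses the same chart in
  -- source and target and is a partial derivative of `f`.
  have hmf : (fun t : ℝ => (mfderiv (𝓡 m) (𝓡 m) (Φ t) z :
      EuclideanSpace ℝ (Fin m) →L[ℝ] EuclideanSpace ℝ (Fin m))) =ᶠ[nhds 0]
      fun t => (fderiv ℝ f (t, e z)).comp (ContinuousLinearMap.inr ℝ ℝ _) := by
    obtain ⟨ε, hε, U, hU, hs, h⟩ := hΦ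
    have hcont : Filter.Tendsto (fun t : ℝ => (t, e z)) (nhds 0) (nhds (0, e z)) := by
      exact (Continuous.prodMk_left (e z)).continuousAt
    filter_upwards [hfix, Ioo_mem_nhds (show -ε < 0 by linarith) hε, hcont.eventually hf1]
      with t ht htε htd
    have h1 : ContMDiffAt (𝓡 m) (𝓡 m) ∞ (Φ t) z :=
      ContMDiffAt.comp z (g := fun p : ℝ × P => Φ p.1 p.2) (f := fun w => (t, w))
        (hs.contMDiffAt (prod_mem_nhds (Ioo_mem_nhds htε.1 htε.2) hU))
        (contMDiffAt_const.prodMk contMDiffAt_id)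
    rw [(h1.mdifferentiableAt (by simp)).mfderiv]
    have h2 : fderivWithin ℝ (writtenInExtChartAt (𝓡 m) (𝓡 m) z (Φ t)) (Set.range (𝓡 m))
        (extChartAt (𝓡 m) z z) = fderiv ℝ (fun y => f (t, y)) (e z) := by
      simp only [mfld_simps, fderivWithin_univ, ht]
      rfl
    refine h2.trans ?_
    exact (htd.hasFDerivAt.comp (e z) (hasFDerivAt_prodMk_right t (e z))).fderiv
  have hd : HasDerivAt (fun t : ℝ => (fderiv ℝ f (t, e z)).comp
      (ContinuousLinearMap.inr ℝ ℝ (EuclideanSpace ℝ (Fin m))))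
      ((fderiv ℝ (fderiv ℝ f) (0, e z) (1, 0)).comp (ContinuousLinearMap.inr ℝ ℝ _)) 0 := by
    have h1 : HasDerivAt (fun t : ℝ => (t, e z)) (1, 0) 0 :=
      (hasDerivAt_id 0).prodMk (hasDerivAt_const 0 (e z))
    have h2 := hf'.hasFDerivAt.comp_hasDerivAt (0 : ℝ) h1
    have h3 := h2.clm_comp (hasDerivAt_const (0 : ℝ)
      (ContinuousLinearMap.inr ℝ ℝ (EuclideanSpace ℝ (Fin m))))
    simpa using h3
  have hL : linearization Φ z =
      (fderiv ℝ (fderiv ℝ f) (0, e z) (1, 0)).comp (ContinuousLinearMap.inr ℝ ℝ _) :=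
    hmf.deriv_eq.trans hd.deriv
  -- Exchanging the time and space derivatives turns the derivative of the flow's tangent map into
  -- the derivative of the vector field.
  have hsym : IsSymmSndFDerivAt ℝ f (0, e z) := hf.isSymmSndFDerivAt (by
    rw [minSmoothness_of_isRCLikeNormedField]; exact ENat.LEInfty.out)
  have hr := ((hf'.hasFDerivAt.comp (e z) (hasFDerivAt_prodMk_right (0 : ℝ) (e z))).clm_apply
    (hasFDerivAt_const ((1 : ℝ), (0 : EuclideanSpace ℝ (Fin m))) (e z))).fderiv
  have hr' := DFunLike.congr_fun hr v
  refine (DFunLike.congr_fun hL v).trans ((hsym.eq (1, 0) (0, v)).trans ?_)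
  refine Eq.trans ?_ hr'.symm
  simp

/-- Let `X[F] = G`. The linearization `L` of `X` at an equilibrium `z` satisfies
`dF(z) ∘ L = dG(z)`. -/
theorem IsLocalFlow.differential_linearization [IsManifold (𝓡 m) ∞ P]
    {X : (w : P) → TangentSpace (𝓡 m) w} {z : P}
    {Φ : ℝ → P → P} (hΦ : IsLocalFlow X z Φ) (hfix : ∀ᶠ t in nhds (0 : ℝ), Φ t z = z)
    {F G : C^∞⟮𝓡 m, P; ℝ⟯} (hFG : ∀ w, differential F w (X w) = G w) (v : TangentSpace (𝓡 m) z) :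
    differential F z (linearization Φ z v) = differential G z v := by
  have hf := hΦ.contDiffAt
  have hL := hΦ.linearization_apply hfix v
  set e := chartAt (EuclideanSpace ℝ (Fin m)) z with he
  set f := fun p : ℝ × EuclideanSpace ℝ (Fin m) => e (Φ p.1 (e.symm p.2)) with hfdef
  set Xe := fun y => fderiv ℝ f (0, y) (1, 0) with hXe
  have hez : z ∈ e.source := mem_chart_source _ z
  have hsymm : ContMDiffAt (𝓡 m) (𝓡 m) ∞ e.symm (e z) :=
    contMDiffOn_chart_symm.contMDiffAt (chart_target_mem_nhds _ z)
  have hrep : ∀ K : C^∞⟮𝓡 m, P; ℝ⟯, ContDiffAt ℝ ∞ (fun y => K (e.symm y)) (e z) := fun K =>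
    (K.contMDiff.contMDiffAt.comp (e z) hsymm).contDiffAt
  have hdiff : ∀ (K : C^∞⟮𝓡 m, P; ℝ⟯) (v : TangentSpace (𝓡 m) z),
      differential K z v = fderiv ℝ (fun y => K (e.symm y)) (e z) v := by
    intro K v
    have hmd : MDifferentiableAt (𝓡 m) 𝓘(ℝ, ℝ) K z := K.contMDiff.mdifferentiableAt (by simp)
    refine (DFunLike.congr_fun hmd.mfderiv v).trans ?_
    simp only [mfld_simps, fderivWithin_univ]
    rfl
  have hf1 : ∀ᶠ p in nhds ((0 : ℝ), e z), DifferentiableAt ℝ f p :=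
    ((hf.of_le (m := 1) (by simp)).eventually (by simp)).mono fun p hp =>
      hp.differentiableAt (by simp)
  have hf' : DifferentiableAt ℝ (fderiv ℝ f) (0, e z) :=
    (hf.fderiv_right (m := 1) (by norm_cast)).differentiableAt (by simp)
  have hcont : Filter.Tendsto (fun y => ((0 : ℝ), y)) (nhds (e z)) (nhds (0, e z)) :=
    (Continuous.prodMk_right (0 : ℝ)).continuousAt
  have hcs : Filter.Tendsto e.symm (nhds (e z)) (nhds z) := by
    have := hsymm.continuousAt
    rwa [ContinuousAt, e.left_inv hez] at this
  have hline : ∀ y : EuclideanSpace ℝ (Fin m), HasDerivAt (fun t : ℝ => (t, y)) (1, 0) 0 :=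
    fun y => (hasDerivAt_id 0).prodMk (hasDerivAt_const 0 y)
  have hXder : ∀ᶠ y in nhds (e z), HasDerivAt (fun t => f (t, y)) (Xe y) 0 := by
    filter_upwards [hcont.eventually hf1] with y hy
    exact hy.hasFDerivAt.comp_hasDerivAt (0 : ℝ) (hline y)
  -- The flow line through the equilibrium is constant.
  have hX0 : Xe (e z) = 0 := by
    refine hXder.self_of_nhds.unique ((hasDerivAt_const 0 (e z)).congr_of_eventuallyEq ?_)
    filter_upwards [hfix] with t ht
    simp [hfdef, e.left_inv hez, ht]
  have hXd : HasFDerivAt Xe (fderiv ℝ Xe (e z)) (e z) := by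
    refine DifferentiableAt.hasFDerivAt ?_
    exact ((hf'.comp (e z) (hasFDerivAt_prodMk_right (0 : ℝ) (e z)).differentiableAt).clm_apply
      (differentiableAt_const _))
  set Fe := fun y => F (e.symm y) with hFe
  have hFd : ∀ᶠ y in nhds (e z), DifferentiableAt ℝ Fe y :=
    (((hrep F).of_le (m := 1) (by simp)).eventually (by simp)).mono fun p hp =>
      hp.differentiableAt (by simp)
  -- The relation `X[F] = G` in coordinates, obtained by computing the time derivative of `F` along
  -- the flow in two ways.
  have hkey : (fun y => fderiv ℝ Fe y (Xe y)) =ᶠ[nhds (e z)] fun y => G (e.symm y) := by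
    filter_upwards [hXder, hFd, hcs.eventually (hΦ.hasDerivAt_comp F),
      chart_target_mem_nhds (EuclideanSpace ℝ (Fin m)) z] with y hy1 hy2 hy3 hy4
    obtain ⟨h0, hc, h1⟩ := hy3
    have hf0 : f (0, y) = y := by simp [hfdef, h0, e.right_inv hy4]
    have h2 : HasDerivAt (fun t => Fe (f (t, y))) (fderiv ℝ Fe y (Xe y)) 0 := by
      have h3 := hy2.hasFDerivAt
      rw [← hf0] at h3
      have := h3.comp_hasDerivAt (0 : ℝ) hy1
      rw [hf0] at this
      exact this
    have h4 : ∀ᶠ t in nhds (0 : ℝ), Φ t (e.symm y) ∈ e.source :=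
      hc.eventually (e.open_source.mem_nhds (by
        simpa only [h0] using e.map_target hy4))
    have h5 : (fun t => Fe (f (t, y))) =ᶠ[nhds 0] fun t => F (Φ t (e.symm y)) := by
      filter_upwards [h4] with t ht
      simp [hFe, hfdef, e.left_inv ht]
    rw [h2.unique (h1.congr_of_eventuallyEq h5), hFG]
  have hFdd : DifferentiableAt ℝ (fderiv ℝ Fe) (e z) :=
    ((hrep F).fderiv_right (m := 1) (by norm_cast)).differentiableAt (by simp)
  -- Product rule for `dF(X)`: the term with the second derivative of `F` is evaluated on `X`, which
  -- is zero at the equilibrium.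
  have h1 := (hFdd.hasFDerivAt.clm_apply hXd).fderiv
  rw [hkey.fderiv_eq] at h1
  rw [hdiff, hdiff, h1, hX0]
  simp only [map_zero, add_zero]
  rw [hL]
  rfl

end LocalFlow

/-! ### The linearization of a Hamiltonian vector field. -/

namespace PoissonStructure

variable {m : ℕ} {P : Type u} [TopologicalSpace P] [ChartedSpace (EuclideanSpace ℝ (Fin m)) P]
  (π : PoissonStructure m P) [T2Space P] [IsManifold (𝓡 m) ∞ P]

/-- The components of the field in a chart are its brackets with the coordinate functions, which are
smooth. This supplies the regularity needed for uniqueness of integral curves. -/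
theorem contMDiffAt_hamiltonianVectorField (H : C^∞⟮𝓡 m, P; ℝ⟯) (z : P) :
    ContMDiffAt (𝓡 m) (𝓡 m).tangent 1
      (fun w => (⟨w, π.hamiltonianVectorField H w⟩ : TangentBundle (𝓡 m) P)) z := by
  have : IsManifold (𝓡 m) 1 P := .of_le (n := ∞) (by simp)
  refine (Bundle.contMDiffAt_section z).2 ?_
  have he := IsManifold.chart_mem_maximalAtlas (I := 𝓡 m) (n := ∞) z
  have hz := mem_chart_source (EuclideanSpace ℝ (Fin m)) z
  set e := chartAt (EuclideanSpace ℝ (Fin m)) z with hedef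
  choose F hF using fun a : Fin m => exists_eventuallyEq_chart he (EuclideanSpace.proj a) hz
  have h1 : ContMDiffAt (𝓡 m) 𝓘(ℝ, EuclideanSpace ℝ (Fin m)) 1
      (fun w => (EuclideanSpace.equiv (Fin m) ℝ).symm fun a => π.bracket (F a) H w) z := by
    have h2 : ContMDiffAt (𝓡 m) 𝓘(ℝ, Fin m → ℝ) 1 (fun w a => π.bracket (F a) H w) z :=
      contMDiffAt_pi_space.2 fun a => ((π.bracket (F a) H).contMDiff.of_le (by simp)).contMDiffAt
    exact ((EuclideanSpace.equiv (Fin m) ℝ).symm.contDiff.contMDiff.contMDiffAt).comp z h2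
  refine h1.congr_of_eventuallyEq ?_
  filter_upwards [e.open_source.mem_nhds hz,
    Filter.eventually_all.2 fun a => (hF a).eventually_nhds] with w hw hFw
  have h2 := DFunLike.congr_fun
    (TangentBundle.continuousLinearMapAt_trivializationAt (I := 𝓡 m) (x₀ := z) hw)
    (π.hamiltonianVectorField H w)
  -- Near `z`, the tangent bundle trivialization is the derivative of the chart.
  have h3 : (trivializationAt (EuclideanSpace ℝ (Fin m)) (TangentSpace (𝓡 m)) z
      ⟨w, π.hamiltonianVectorField H w⟩).2 =
      (mfderiv (𝓡 m) (𝓡 m) e w : EuclideanSpace ℝ (Fin m) →L[ℝ] EuclideanSpace ℝ (Fin m))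
        (π.hamiltonianVectorField H w) := by
    rw [Bundle.Trivialization.continuousLinearMapAt_apply,
      Bundle.Trivialization.linearMapAt_apply, if_pos] at h2
    · refine h2.trans ?_
      simp only [mfld_simps]
      rfl
    · simpa using hw
  rw [h3]
  ext a
  have h4 := differential_of_eventuallyEq_chart he (EuclideanSpace.proj a) hw (hFw a)
    (π.hamiltonianVectorField H w)
  rw [differential_hamiltonianVectorField] at h4
  exact h4.symm

/-- The linearization `L` of a Hamiltonian vector field satisfies `dF ∘ L = d{F, H}`. -/
theorem differential_linearization {H : C^∞⟮𝓡 m, P; ℝ⟯} {z : P}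
    (hz : π.hamiltonianVectorField H z = 0) {Φ : ℝ → P → P}
    (hΦ : IsLocalFlow (π.hamiltonianVectorField H) z Φ) (F : C^∞⟮𝓡 m, P; ℝ⟯)
    (v : TangentSpace (𝓡 m) z) :
    differential F z (linearization Φ z v) = differential (π.bracket F H) z v :=
  hΦ.differential_linearization
    (hΦ.eventually_eq_self (π.contMDiffAt_hamiltonianVectorField H z) hz)
    (fun w => π.differential_hamiltonianVectorField F H w) v

/-- Duality: a vector outside the characteristic space is separated from it by a covector `dA(z)`.
Annihilating that space means `{A, G}(z) = 0` for all `G`, so `dA ∘ L = d{A, H} = 0` at the regular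
point `z`. -/
theorem linearization_mem_characteristicSpace {H : C^∞⟮𝓡 m, P; ℝ⟯} {z : P}
    (hreg : π.IsRegularPoint z) (hz : π.hamiltonianVectorField H z = 0) {Φ : ℝ → P → P}
    (hΦ : IsLocalFlow (π.hamiltonianVectorField H) z Φ) (v : TangentSpace (𝓡 m) z) :
    linearization Φ z v ∈ π.characteristicSpace z := by
  by_contra hv
  obtain ⟨β, hβ, hker⟩ := Submodule.exists_le_ker_of_notMem hv
  obtain ⟨A, hA⟩ := exists_differential_eq β
  refine hβ ?_
  rw [← hA, π.differential_linearization hz hΦ, π.differential_bracket_eq_zero hreg]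
  · rfl
  · intro G
    rw [← differential_hamiltonianVectorField, hA]
    exact hker (π.hamiltonianVectorField_mem G z)
  · intro F
    rw [← differential_hamiltonianVectorField, hz, map_zero]

end PoissonStructure

end PoissonLin

namespace PoissonLin

/-! ### Differentials and brackets in an arbitrary chart. -/

section ChartCalculus

variable {m : ℕ} {P : Type u} [TopologicalSpace P] [ChartedSpace (EuclideanSpace ℝ (Fin m)) P]
  {e : OpenPartialHomeomorph P (EuclideanSpace ℝ (Fin m))}

theorem contDiffAt_comp_symm (he : e ∈ IsManifold.maximalAtlas (𝓡 m) ∞ P) {z : P}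
    (hz : z ∈ e.source) (K : C^∞⟮𝓡 m, P; ℝ⟯) : ContDiffAt ℝ ∞ (fun y => K (e.symm y)) (e z) :=
  (K.contMDiff.contMDiffAt.comp (e z) ((contMDiffOn_symm_of_mem_maximalAtlas he).contMDiffAt
    (e.open_target.mem_nhds (e.map_source hz)))).contDiffAt

theorem differential_eq_fderiv (he : e ∈ IsManifold.maximalAtlas (𝓡 m) ∞ P) {z : P}
    (hz : z ∈ e.source) (K : C^∞⟮𝓡 m, P; ℝ⟯) (v : TangentSpace (𝓡 m) z) :
    differential K z v = fderiv ℝ (fun y => K (e.symm y)) (e z)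
      ((mfderiv (𝓡 m) (𝓡 m) e z : EuclideanSpace ℝ (Fin m) →L[ℝ] EuclideanSpace ℝ (Fin m)) v) := by
  have h1 := ((mdifferentiable_of_mem_maximalAtlas he).mdifferentiableAt hz).hasMFDerivAt
  have h2 : HasMFDerivAt (𝓡 m) 𝓘(ℝ, ℝ) (fun y => K (e.symm y)) (e z)
      (fderiv ℝ (fun y => K (e.symm y)) (e z)) :=
    ((contDiffAt_comp_symm he hz K).differentiableAt (by simp)).hasFDerivAt.hasMFDerivAt
  have h3 := (h2.comp z h1).mfderiv
  have h4 : (K : P → ℝ) =ᶠ[nhds z] (fun y => K (e.symm y)) ∘ e := by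
    filter_upwards [e.open_source.mem_nhds hz] with w hw
    simp [e.left_inv hw]
  have h5 : differential K z = mfderiv (𝓡 m) 𝓘(ℝ, ℝ) ((fun y => K (e.symm y)) ∘ e) z :=
    h4.mfderiv_eq
  rw [h5, h3]
  rfl

theorem differential_mfderiv_symm (he : e ∈ IsManifold.maximalAtlas (𝓡 m) ∞ P) {z : P}
    (hz : z ∈ e.source) (K : C^∞⟮𝓡 m, P; ℝ⟯) (y : EuclideanSpace ℝ (Fin m))
    {v : TangentSpace (𝓡 m) z} (hv : v = (mfderiv (𝓡 m) (𝓡 m) e.symm (e z) :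
      EuclideanSpace ℝ (Fin m) →L[ℝ] EuclideanSpace ℝ (Fin m)) y) :
    differential K z v = fderiv ℝ (fun y => K (e.symm y)) (e z) y := by
  rw [differential_eq_fderiv he hz K, hv]
  congr 1
  have hmd := mdifferentiable_of_mem_maximalAtlas he
  exact (hmd.mfderiv hz).apply_symm_apply y

theorem partialDeriv_comm {f : EuclideanSpace ℝ (Fin m) → ℝ} {y : EuclideanSpace ℝ (Fin m)}
    (hf : ContDiffAt ℝ ∞ f y) (a b : Fin m) :
    partialDeriv a (partialDeriv b f) y = partialDeriv b (partialDeriv a f) y := by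
  have hf' : DifferentiableAt ℝ (fderiv ℝ f) y :=
    (hf.fderiv_right (m := 1) (by norm_cast)).differentiableAt (by simp)
  have h : ∀ a b : Fin m, partialDeriv a (partialDeriv b f) y =
      fderiv ℝ (fderiv ℝ f) y (EuclideanSpace.single a 1) (EuclideanSpace.single b 1) := by
    intro a b
    have := (hf'.hasFDerivAt.clm_apply
      (hasFDerivAt_const (EuclideanSpace.single b (1 : ℝ)) y)).fderiv
    refine (DFunLike.congr_fun this _).trans ?_
    simp
  have hsym : IsSymmSndFDerivAt ℝ f y := hf.isSymmSndFDerivAt (by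
    rw [minSmoothness_of_isRCLikeNormedField]; exact ENat.LEInfty.out)
  rw [h, h, hsym.eq]

theorem differentiableAt_partialDeriv {f : EuclideanSpace ℝ (Fin m) → ℝ}
    {y : EuclideanSpace ℝ (Fin m)} (hf : ContDiffAt ℝ ∞ f y) (a : Fin m) :
    DifferentiableAt ℝ (partialDeriv a f) y :=
  ((hf.fderiv_right (m := 1) (by norm_cast)).differentiableAt (by simp)).clm_apply
    (differentiableAt_const _)

/-- The Poisson bracket in the coordinates of a chart. -/
theorem PoissonStructure.bracket_eq_sum_partialDeriv (π : PoissonStructure m P)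
    [T2Space P] [IsManifold (𝓡 m) ∞ P]
    (he : e ∈ IsManifold.maximalAtlas (𝓡 m) ∞ P) {w : P} (hw : w ∈ e.source)
    {F : Fin m → C^∞⟮𝓡 m, P; ℝ⟯} (hF : ∀ a, (F a : P → ℝ) =ᶠ[nhds w] fun w' => e w' a)
    (A H : C^∞⟮𝓡 m, P; ℝ⟯) :
    π.bracket A H w =
      ∑ a, π.bracket A (F a) w * partialDeriv a (fun y => H (e.symm y)) (e w) := by
  rw [π.bracket_antisymm A H]
  change -(π.bracket H A w) = _
  rw [← π.differential_hamiltonianVectorField, differential_eq_fderiv he hw]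
  set u : EuclideanSpace ℝ (Fin m) :=
    (mfderiv (𝓡 m) (𝓡 m) e w : EuclideanSpace ℝ (Fin m) →L[ℝ] EuclideanSpace ℝ (Fin m))
      (π.hamiltonianVectorField A w) with hu
  -- The components of the Hamiltonian vector of `A` are its brackets with the coordinates; the sign
  -- from antisymmetry cancels the one introduced above.
  have h1 : ∀ a, u a = -π.bracket A (F a) w := by
    intro a
    have := differential_of_eventuallyEq_chart he (EuclideanSpace.proj a) hw (hF a)
      (π.hamiltonianVectorField A w)
    rw [π.differential_hamiltonianVectorField, π.bracket_antisymm] at this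
    exact this.symm
  have h2 : u = ∑ a, u a • EuclideanSpace.single a (1 : ℝ) := by
    ext i
    simp [Finset.sum_apply, Pi.single_apply]
  rw [h2, map_sum, ← Finset.sum_neg_distrib]
  refine Finset.sum_congr rfl fun a _ => ?_
  rw [map_smul, h1, smul_eq_mul, neg_mul, neg_neg]
  rfl

end ChartCalculus

/-! ### The matrix of the linearization in Darboux–Weinstein coordinates. -/

namespace DarbouxWeinsteinChart

variable {m : ℕ} {P : Type u} [TopologicalSpace P] [ChartedSpace (EuclideanSpace ℝ (Fin m)) P]
  {π : PoissonStructure m P} {z₀ : P} {n r : ℕ} (c : DarbouxWeinsteinChart π z₀ n r)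

/-- The transverse coordinates. -/
noncomputable def transverse : EuclideanSpace ℝ (Fin m) →L[ℝ] (Fin r → ℝ) :=
  ContinuousLinearMap.pi fun k => EuclideanSpace.proj (c.index (Sum.inr k))

/-- The inclusion of the transversal `q = p = 0`. -/
noncomputable def transversal (z : Fin r → ℝ) : EuclideanSpace ℝ (Fin m) :=
  WithLp.toLp 2 fun i => Sum.elim 0 z (c.index.symm i)

theorem contDiff_transversal : ContDiff ℝ ∞ c.transversal := by
  rw [contDiff_euclidean]
  intro i
  change ContDiff ℝ ∞ fun z : Fin r → ℝ =>
    (Sum.elim 0 z (c.index.symm i) : ℝ)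
  rcases c.index.symm i with j | k
  · exact contDiff_const
  · exact contDiff_apply ℝ ℝ k

theorem transversal_zero : c.transversal 0 = 0 := by
  ext i
  change (Sum.elim 0 0 (c.index.symm i) : ℝ) = 0
  rcases c.index.symm i with j | k <;> rfl

theorem transverse_transversal (z : Fin r → ℝ) : c.transverse (c.transversal z) = z := by
  ext k
  change (Sum.elim 0 z (c.index.symm (c.index (Sum.inr k))) : ℝ) = z k
  rw [Equiv.symm_apply_apply]
  rfl

theorem transverse_single_inl (j : Fin n ⊕ Fin n) :
    c.transverse (EuclideanSpace.single (c.index (Sum.inl j)) 1) = 0 := by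
  ext k
  change EuclideanSpace.single (c.index (Sum.inl j)) (1 : ℝ) (c.index (Sum.inr k)) = 0
  simp

theorem transverse_single_inr (l : Fin r) :
    c.transverse (EuclideanSpace.single (c.index (Sum.inr l)) 1) = Pi.single l 1 := by
  ext k
  change EuclideanSpace.single (c.index (Sum.inr l)) (1 : ℝ) (c.index (Sum.inr k)) = _
  simp [Pi.single_apply]

/-- The matrix of the Poisson tensor at the point with coordinates `y`. -/
noncomputable def tensor (y : EuclideanSpace ℝ (Fin m)) :
    Matrix ((Fin n ⊕ Fin n) ⊕ Fin r) ((Fin n ⊕ Fin n) ⊕ Fin r) ℝ :=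
  Matrix.fromBlocks (symplecticJ n) 0 0 (c.R (c.transverse y))

theorem tendsto_symm : Filter.Tendsto c.chart.symm (nhds 0) (nhds z₀) := by
  have h := c.chart.symm.continuousAt (x := c.chart z₀) (c.chart.map_source c.mem_source)
  rwa [ContinuousAt, c.chart.left_inv c.mem_source, c.map_base] at h

theorem contDiffAt_localRep (H : C^∞⟮𝓡 m, P; ℝ⟯) : ContDiffAt ℝ ∞ (c.localRep H) 0 := by
  rw [← c.map_base]
  exact contDiffAt_comp_symm c.mem_maximalAtlas c.mem_source H

/-- The symplectic rows of the Poisson tensor are constant, so only the Hessian of `H` survives;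
symmetry of second derivatives puts the indices in the order used by the blocks. -/
theorem partialDeriv_tensor_inl (H : C^∞⟮𝓡 m, P; ℝ⟯) (i : Fin n ⊕ Fin n) (a : Fin m) :
    partialDeriv a (fun y =>
      ∑ b, c.tensor y (Sum.inl i) b * partialDeriv (c.index b) (c.localRep H) y) 0 =
    ∑ p, symplecticJ n i p *
      partialDeriv (c.index (Sum.inl p)) (partialDeriv a (c.localRep H)) 0 := by
  have h1 : (fun y => ∑ b, c.tensor y (Sum.inl i) b *
      partialDeriv (c.index b) (c.localRep H) y) =
      fun y => ∑ p, symplecticJ n i p * partialDeriv (c.index (Sum.inl p)) (c.localRep H) y := by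
    ext y
    simp [Fintype.sum_sum_type, tensor]
  have h2 := HasFDerivAt.fun_sum (u := Finset.univ) fun (p : Fin n ⊕ Fin n) _ =>
    (differentiableAt_partialDeriv (c.contDiffAt_localRep H)
      (c.index (Sum.inl p))).hasFDerivAt.const_mul (symplecticJ n i p)
  rw [h1, partialDeriv, h2.fderiv]
  simp only [sum_apply, smul_apply, smul_eq_mul]
  refine Finset.sum_congr rfl fun p _ => ?_
  rw [partialDeriv_comm (c.contDiffAt_localRep H)]
  rfl

/-- The coordinate matrix is the matrix of `L` in the basis `∂/∂y^b`, the image of the standard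
basis under the inverse of the chart's derivative. -/
theorem charpoly_coordMatrix (L : TangentSpace (𝓡 m) z₀ →L[ℝ] TangentSpace (𝓡 m) z₀) :
    (c.coordMatrix L).charpoly = L.toLinearMap.charpoly := by
  let A := (mdifferentiable_of_mem_maximalAtlas c.mem_maximalAtlas).mfderiv c.mem_source
  let A' : EuclideanSpace ℝ (Fin m) ≃ₗ[ℝ] TangentSpace (𝓡 m) z₀ := A.symm.toLinearEquiv
  let b : Module.Basis ((Fin n ⊕ Fin n) ⊕ Fin r) ℝ (TangentSpace (𝓡 m) z₀) :=
    ((EuclideanSpace.basisFun (Fin m) ℝ).toBasis.reindex c.index.symm).map A'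
  have h : c.coordMatrix L = LinearMap.toMatrix b b L.toLinearMap := by
    ext i j
    rw [LinearMap.toMatrix_apply]
    have h1 : b j = A' (EuclideanSpace.single (c.index j) 1) := by simp [b]
    rw [h1]
    rfl
  rw [h, LinearMap.charpoly_toMatrix]

variable [T2Space P] [IsManifold (𝓡 m) ∞ P]

theorem exists_coord : ∃ F : (Fin n ⊕ Fin n) ⊕ Fin r → C^∞⟮𝓡 m, P; ℝ⟯,
    ∀ a, (F a : P → ℝ) =ᶠ[nhds z₀] fun w => c.chart w (c.index a) := by
  choose F hF using fun a => exists_eventuallyEq_chart c.mem_maximalAtlas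
    (EuclideanSpace.proj (c.index a)) c.mem_source
  exact ⟨F, hF⟩

variable {F : (Fin n ⊕ Fin n) ⊕ Fin r → C^∞⟮𝓡 m, P; ℝ⟯}
  (hF : ∀ a, (F a : P → ℝ) =ᶠ[nhds z₀] fun w => c.chart w (c.index a))

include hF

omit [T2Space P] [IsManifold (𝓡 m) ∞ P] in
theorem eventually_bracket_coord :
    ∀ᶠ w in nhds z₀, ∀ a b, π.bracket (F a) (F b) w = c.tensor (c.chart w) a b := by
  filter_upwards [c.chart.open_source.mem_nhds c.mem_source,
    Filter.eventually_all.2 fun a => (hF a).eventually_nhds] with w hw hFw a b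
  exact c.bracket_coord w hw a b _ _ (hFw a) (hFw b)

theorem eventually_bracket_eq (A H : C^∞⟮𝓡 m, P; ℝ⟯) :
    ∀ᶠ w in nhds z₀, π.bracket A H w =
      ∑ b, π.bracket A (F b) w * partialDeriv (c.index b) (c.localRep H) (c.chart w) := by
  filter_upwards [c.chart.open_source.mem_nhds c.mem_source,
    Filter.eventually_all.2 fun a => (hF a).eventually_nhds] with w hw hFw
  rw [π.bracket_eq_sum_partialDeriv c.mem_maximalAtlas hw (F := fun i => F (c.index.symm i))
    (fun i => by
      have h := hFw (c.index.symm i)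
      rwa [Equiv.apply_symm_apply] at h), ← c.index.sum_comp]
  simp only [Equiv.symm_apply_apply]
  rfl

theorem eventually_localRep_bracket (H : C^∞⟮𝓡 m, P; ℝ⟯) (a) :
    c.localRep (π.bracket (F a) H) =ᶠ[nhds 0] fun y =>
      ∑ b, c.tensor y a b * partialDeriv (c.index b) (c.localRep H) y := by
  have ht : c.chart.target ∈ nhds (0 : EuclideanSpace ℝ (Fin m)) := by
    rw [← c.map_base]
    exact c.chart.open_target.mem_nhds (c.chart.map_source c.mem_source)
  filter_upwards [(c.tendsto_symm).eventually (c.eventually_bracket_coord hF),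
    (c.tendsto_symm).eventually (c.eventually_bracket_eq hF (F a) H), ht] with y h1 h2 hy
  rw [localRep, h2]
  simp only [h1, c.chart.right_inv hy]

-- Smoothness of `R` is not part of the chart's data. It is recovered by restricting the smooth
-- functions `{z^k, z^p}` to the transversal `q = p = 0`.
omit [T2Space P] [IsManifold (𝓡 m) ∞ P] in
theorem differentiableAt_R (k p : Fin r) : DifferentiableAt ℝ (fun z => c.R z k p) 0 := by
  have hs : Filter.Tendsto c.transversal (nhds 0) (nhds 0) := by
    have := c.contDiff_transversal.continuous.tendsto 0
    rwa [transversal_zero] at this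
  have ht : c.chart.target ∈ nhds (0 : EuclideanSpace ℝ (Fin m)) := by
    rw [← c.map_base]
    exact c.chart.open_target.mem_nhds (c.chart.map_source c.mem_source)
  have h1 : (fun z => c.R z k p) =ᶠ[nhds 0] fun z =>
      c.localRep (π.bracket (F (Sum.inr k)) (F (Sum.inr p))) (c.transversal z) := by
    filter_upwards [hs.eventually ((c.tendsto_symm).eventually (c.eventually_bracket_coord hF)),
      hs.eventually ht] with z hz hz'
    rw [localRep, hz, c.chart.right_inv hz', tensor, Matrix.fromBlocks_apply₂₂,
      transverse_transversal]
  have h2 := contDiffAt_comp_symm c.mem_maximalAtlas c.mem_source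
    (π.bracket (F (Sum.inr k)) (F (Sum.inr p)))
  rw [c.map_base, ← c.transversal_zero] at h2
  have h3 := h2.comp (0 : Fin r → ℝ) c.contDiff_transversal.contDiffAt
  exact (h3.differentiableAt (by simp)).congr_of_eventuallyEq h1

variable {H : C^∞⟮𝓡 m, P; ℝ⟯} {L : TangentSpace (𝓡 m) z₀ →L[ℝ] TangentSpace (𝓡 m) z₀}

-- The vector `v` is `∂/∂y^b` at `z₀`. This turns matrix entries into differentials of global
-- functions, to which intrinsic facts about `L` apply.
omit [T2Space P] [IsManifold (𝓡 m) ∞ P] in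
theorem coordMatrix_apply_eq_differential (a b) :
    ∃ v : TangentSpace (𝓡 m) z₀, c.coordMatrix L a b = differential (F a) z₀ (L v) ∧
      ∀ K : C^∞⟮𝓡 m, P; ℝ⟯, differential K z₀ v = partialDeriv (c.index b) (c.localRep K) 0 := by
  have h0 : c.chart.symm (c.chart z₀) = z₀ := c.chart.left_inv c.mem_source
  let v : TangentSpace (𝓡 m) z₀ := (mfderiv (𝓡 m) (𝓡 m) c.chart.symm (c.chart z₀) :
    EuclideanSpace ℝ (Fin m) →L[ℝ] EuclideanSpace ℝ (Fin m)) (EuclideanSpace.single (c.index b) 1)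
  refine ⟨v, ?_, fun K => ?_⟩
  · exact (differential_of_eventuallyEq_chart c.mem_maximalAtlas
      (EuclideanSpace.proj (c.index a)) c.mem_source (hF a) (L v)).symm
  · rw [differential_mfderiv_symm c.mem_maximalAtlas c.mem_source K _ rfl, c.map_base]
    rfl

theorem coordMatrix_apply_eq_partialDeriv
    (hL : ∀ K v, differential K z₀ (L v) = differential (π.bracket K H) z₀ v) (a b) :
    c.coordMatrix L a b = partialDeriv (c.index b) (fun y =>
      ∑ b, c.tensor y a b * partialDeriv (c.index b) (c.localRep H) y) 0 := by
  obtain ⟨v, hv, hK⟩ := c.coordMatrix_apply_eq_differential hF (L := L) a b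
  rw [hv, hL, hK, partialDeriv, (c.eventually_localRep_bracket hF H a).fderiv_eq]
  rfl

/-- At `z₀` a transverse coordinate has zero bracket with every coordinate, since `R 0 = 0`; its
differential therefore annihilates the characteristic space, which contains the range of `L`. -/
theorem coordMatrix_inr_eq_zero (hL : ∀ v, L v ∈ π.characteristicSpace z₀) (k b) :
    c.coordMatrix L (Sum.inr k) b = 0 := by
  obtain ⟨v, hv, -⟩ := c.coordMatrix_apply_eq_differential hF (L := L) (Sum.inr k) b
  obtain ⟨G, hG⟩ := hL v
  have hG' : π.hamiltonianVectorField G z₀ = L v := hG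
  rw [hv, ← hG', π.differential_hamiltonianVectorField,
    (c.eventually_bracket_eq hF (F (Sum.inr k)) G).self_of_nhds]
  refine Finset.sum_eq_zero fun b _ => ?_
  rw [(c.eventually_bracket_coord hF).self_of_nhds, c.map_base, tensor, map_zero, c.R_zero]
  rcases b with j | l <;> simp

-- The transverse rows of the tensor vanish at the origin, so in the product rule the Hessian of `H`
-- drops out and only the derivative of `R` remains.
omit [T2Space P] [IsManifold (𝓡 m) ∞ P] in
theorem partialDeriv_tensor_inr (k : Fin r) (a : Fin m) :
    partialDeriv a (fun y =>
      ∑ b, c.tensor y (Sum.inr k) b * partialDeriv (c.index b) (c.localRep H) y) 0 =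
    ∑ p, fderiv ℝ (fun z => c.R z k p) 0 (c.transverse (EuclideanSpace.single a 1)) *
      partialDeriv (c.index (Sum.inr p)) (c.localRep H) 0 := by
  have h1 : (fun y => ∑ b, c.tensor y (Sum.inr k) b *
      partialDeriv (c.index b) (c.localRep H) y) =
      fun y => ∑ p, c.R (c.transverse y) k p *
        partialDeriv (c.index (Sum.inr p)) (c.localRep H) y := by
    ext y
    simp [Fintype.sum_sum_type, tensor]
  have h3 : ∀ p, HasFDerivAt (fun y => c.R (c.transverse y) k p)
      ((fderiv ℝ (fun z => c.R z k p) 0).comp c.transverse) 0 := by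
    intro p
    have h4 := (c.differentiableAt_R hF k p).hasFDerivAt
    rw [← map_zero c.transverse] at h4
    have h5 := h4.comp (0 : EuclideanSpace ℝ (Fin m)) c.transverse.hasFDerivAt
    rwa [map_zero] at h5
  have h2 := HasFDerivAt.fun_sum (u := Finset.univ) fun (p : Fin r) _ =>
    (h3 p).fun_mul (differentiableAt_partialDeriv (c.contDiffAt_localRep H)
      (c.index (Sum.inr p))).hasFDerivAt
  rw [h1, partialDeriv, h2.fderiv]
  simp only [sum_apply]
  refine Finset.sum_congr rfl fun p _ => ?_
  simp [c.R_zero, mul_comm]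

omit hF in
/-- The block form of the linearization, for `L` characterized by `dK ∘ L = d{K, H}`. -/
theorem coordMatrix_eq_fromBlocks
    (hL : ∀ K v, differential K z₀ (L v) = differential (π.bracket K H) z₀ v) :
    c.coordMatrix L = Matrix.fromBlocks (c.blockS H) (c.blockQ H) 0 (c.blockP H) := by
  obtain ⟨F, hF⟩ := c.exists_coord
  ext a b
  rw [c.coordMatrix_apply_eq_partialDeriv hF hL]
  rcases a with i | k
  · rw [partialDeriv_tensor_inl]
    rcases b with j | l <;> rfl
  · rw [c.partialDeriv_tensor_inr hF]
    rcases b with j | l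
    · simp [transverse_single_inl]
    · rw [transverse_single_inr]; rfl

-- Two computations of the lower right block are compared: by differentiating the tensor, and by
-- tangency of the range of `L`.
omit hF in
theorem blockP_eq_zero
    (hL : ∀ K v, differential K z₀ (L v) = differential (π.bracket K H) z₀ v)
    (hL' : ∀ v, L v ∈ π.characteristicSpace z₀) : c.blockP H = 0 := by
  obtain ⟨F, hF⟩ := c.exists_coord
  ext k l
  have h := c.coordMatrix_inr_eq_zero hF hL' k (Sum.inr l)
  rwa [c.coordMatrix_eq_fromBlocks hL] at h

end DarbouxWeinsteinChart

end PoissonLin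

namespace PoissonLin

/-! ### Eigenvectors and eigenvalues of an endomorphism with range in a subspace. -/

section LinearAlgebra

theorem mem_of_mem_maxGenEigenspace {K V : Type*} [Field K] [AddCommGroup V] [Module K V]
    {f : Module.End K V} {U : Submodule K V} (hU : ∀ x, f x ∈ U) {μ : K} (hμ : μ ≠ 0) {x : V}
    (hx : x ∈ f.maxGenEigenspace μ) : x ∈ U := by
  obtain ⟨k, hk⟩ := Module.End.mem_maxGenEigenspace f μ x |>.1 hx
  clear hx
  induction k generalizing x with
  | zero =>
    have : x = 0 := by simpa using hk
    rw [this]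
    exact U.zero_mem
  | succ k ih =>
    have h1 : (f - μ • (1 : Module.End K V)) x ∈ U := ih (by rwa [pow_succ] at hk)
    -- `μ x = f x - (f - μ) x`, where the last term is in `U` by induction.
    have h2 := U.sub_mem (hU x) h1
    simp only [LinearMap.sub_apply, LinearMap.smul_apply, Module.End.one_apply,
      sub_sub_cancel] at h2
    exact (U.smul_mem_iff hμ).1 h2

variable {V : Type*} [AddCommGroup V] [Module ℝ V]

theorem baseChange_apply_mem {f : V →ₗ[ℝ] V} {W : Submodule ℝ V} (h : ∀ x, f x ∈ W)
    (x : ℂ ⊗[ℝ] V) : f.baseChange ℂ x ∈ W.baseChange ℂ := by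
  induction x using TensorProduct.induction_on with
  | zero => rw [map_zero]; exact Submodule.zero_mem _
  | tmul a x => exact Submodule.tmul_mem_baseChange_of_mem a (h x)
  | add x y hx hy => rw [map_add]; exact Submodule.add_mem _ hx hy

/-- A real functional that vanishes on `W` but not at `u` would, after base change, separate `1 ⊗ u`
from the complexification of `W`. -/
theorem mem_of_one_tmul_mem_baseChange {W : Submodule ℝ V} {u : V}
    (hu : (1 : ℂ) ⊗ₜ[ℝ] u ∈ W.baseChange ℂ) : u ∈ W := by
  by_contra hW
  obtain ⟨β, hβ, hker⟩ := Submodule.exists_le_ker_of_notMem hW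
  have h1 : W.baseChange ℂ ≤ LinearMap.ker (β.baseChange ℂ) := by
    rw [Submodule.baseChange_eq_span, Submodule.span_le]
    rintro _ ⟨x, hx, rfl⟩
    have : β x = 0 := hker hx
    simp [this]
  have h2 : (1 : ℂ) ⊗ₜ[ℝ] β u = 0 := h1 hu
  have h3 := congrArg (TensorProduct.rid ℝ ℂ) h2
  simp at h3
  exact hβ h3

theorem unstableSpace_subset {f : V →ₗ[ℝ] V} {W : Submodule ℝ V} (h : ∀ x, f x ∈ W) :
    unstableSpace f ⊆ W := by
  intro u hu
  refine mem_of_one_tmul_mem_baseChange ((iSup_le fun μ => ?_ : _ ≤ W.baseChange ℂ) hu)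
  intro x hx
  refine mem_of_mem_maxGenEigenspace (baseChange_apply_mem h) ?_ hx
  intro h0
  have := μ.2
  rw [h0] at this
  exact lt_irrefl _ this

theorem complexEigenvalues_fromBlocks_zero {α β : Type*} [Fintype α] [DecidableEq α] [Fintype β]
    [DecidableEq β] (S : Matrix α α ℝ) (Q : Matrix α β ℝ) :
    complexEigenvalues (Matrix.fromBlocks S Q 0 0) =
      complexEigenvalues S + Multiset.replicate (Fintype.card β) 0 := by
  rw [complexEigenvalues, Matrix.fromBlocks_map, Matrix.map_zero _ (map_zero _),
    Matrix.map_zero _ (map_zero _), Matrix.charpoly_fromBlocks_zero₂₁, Matrix.charpoly_zero,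
    Polynomial.roots_mul, Polynomial.roots_X_pow, Multiset.nsmul_singleton]
  · rfl
  · exact ((Matrix.charpoly_monic _).mul (Polynomial.monic_X_pow _)).ne_zero

end LinearAlgebra

/-- Both sides say that `lam` is a root of the characteristic polynomial, which commutes with base
change to `ℂ`. -/
theorem DarbouxWeinsteinChart.hasEigenvalue_iff {m : ℕ} {P : Type u} [TopologicalSpace P]
    [ChartedSpace (EuclideanSpace ℝ (Fin m)) P] {π : PoissonStructure m P} {z₀ : P} {n r : ℕ}
    (c : DarbouxWeinsteinChart π z₀ n r)
    (L : TangentSpace (𝓡 m) z₀ →L[ℝ] TangentSpace (𝓡 m) z₀) (lam : ℂ) :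
    Module.End.HasEigenvalue
      (L.toLinearMap.baseChange ℂ : Module.End ℂ (ℂ ⊗[ℝ] TangentSpace (𝓡 m) z₀)) lam ↔
      lam ∈ complexEigenvalues (c.coordMatrix L) := by
  rw [Module.End.hasEigenvalue_iff_isRoot_charpoly, LinearMap.charpoly_baseChange,
    ← c.charpoly_coordMatrix, complexEigenvalues,
    Polynomial.mem_roots (Matrix.charpoly_monic _).ne_zero, Matrix.charpoly_map]

end PoissonLin

theorem corollary2p4 {m k : ℕ}
    {P : Type u} [TopologicalSpace P] [T2Space P] [ChartedSpace (EuclideanSpace ℝ (Fin m)) P]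
    [IsManifold (𝓡 m) ∞ P]
    (π : PoissonLin.PoissonStructure m P) (H : C^∞⟮𝓡 m, P; ℝ⟯)
    {N : Type v} [TopologicalSpace N] [ChartedSpace (EuclideanSpace ℝ (Fin k)) N]
    [IsManifold (𝓡 k) ∞ N]
    (ι : N → P) (hleaf : π.IsSymplecticLeaf k ι) (hreg : π.IsRegularLeaf ι)
    (x : N) (heq : π.hamiltonianVectorField H (ι x) = 0)
    (Φ : ℝ → P → P) (hΦ : PoissonLin.IsLocalFlow (π.hamiltonianVectorField H) (ι x) Φ)
    (L : TangentSpace (𝓡 m) (ι x) →L[ℝ] TangentSpace (𝓡 m) (ι x))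
    (hL : L = PoissonLin.linearization Φ (ι x)) :
    -- the block form of the linearization, and the vanishing of its transverse block
    (∀ (n r : ℕ) (c : PoissonLin.DarbouxWeinsteinChart π (ι x) n r),
      c.coordMatrix L = Matrix.fromBlocks (c.blockS H) (c.blockQ H) 0 (c.blockP H) ∧
      c.blockP H = 0) ∧
    -- real eigenvectors, complex eigenvectors, and unstable directions are tangent to the leaf
    (∀ (lam : ℝ) (w : TangentSpace (𝓡 m) (ι x)), lam ≠ 0 → L w = lam • w →
      w ∈ PoissonLin.immersedTangentSpace m k ι x) ∧
    (∀ (lam : ℂ) (w : ℂ ⊗[ℝ] TangentSpace (𝓡 m) (ι x)), lam ≠ 0 →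
      L.toLinearMap.baseChange ℂ w = lam • w →
      w ∈ (PoissonLin.immersedTangentSpace m k ι x).baseChange ℂ) ∧
    (PoissonLin.unstableSpace L.toLinearMap ⊆
      (PoissonLin.immersedTangentSpace m k ι x : Set (TangentSpace (𝓡 m) (ι x)))) ∧
    -- the eigenvalues besides those of the symplectic block
    (∀ (n r : ℕ) (c : PoissonLin.DarbouxWeinsteinChart π (ι x) n r)
      (v : Module.Basis (Fin r) ℂ (Fin r → ℂ)) (μ : Fin r → ℂ),
      (∀ j, (c.blockP H).map (algebraMap ℝ ℂ) *ᵥ v j = μ j • v j) →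
      (∀ j, ∃ w, (c.blockS H).map (algebraMap ℝ ℂ) *ᵥ w =
        (c.blockQ H).map (algebraMap ℝ ℂ) *ᵥ v j) →
      PoissonLin.complexEigenvalues (c.coordMatrix L) =
        PoissonLin.complexEigenvalues (c.blockS H) + Multiset.replicate r 0 ∧
      ∀ lam : ℂ, Module.End.HasEigenvalue
          (L.toLinearMap.baseChange ℂ : Module.End ℂ (ℂ ⊗[ℝ] TangentSpace (𝓡 m) (ι x))) lam ↔
        lam ∈ PoissonLin.complexEigenvalues (c.blockS H) ∨ (lam = 0 ∧ 0 < r)) := by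
  subst hL
  have hd := π.differential_linearization heq hΦ
  have hmem := π.linearization_mem_characteristicSpace (hreg x) heq hΦ
  have hblock : ∀ (n r : ℕ) (c : PoissonLin.DarbouxWeinsteinChart π (ι x) n r),
      c.coordMatrix (PoissonLin.linearization Φ (ι x)) =
        Matrix.fromBlocks (c.blockS H) (c.blockQ H) 0 (c.blockP H) ∧ c.blockP H = 0 :=
    fun n r c => ⟨c.coordMatrix_eq_fromBlocks hd, c.blockP_eq_zero hd hmem⟩
  -- The leaf enters only through its tangent space, which is the characteristic space.
  rw [hleaf.tangent_eq x]
  refine ⟨hblock, ?_, ?_, PoissonLin.unstableSpace_subset hmem, ?_⟩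
  · intro lam w hlam hw
    refine (Submodule.smul_mem_iff _ hlam).1 ?_
    rw [← hw]
    exact hmem w
  · intro lam w hlam hw
    refine (Submodule.smul_mem_iff _ hlam).1 ?_
    rw [← hw]
    exact PoissonLin.baseChange_apply_mem hmem w
  · intro n r c _ _ _ _
    have h : PoissonLin.complexEigenvalues
        (c.coordMatrix (PoissonLin.linearization Φ (ι x))) =
        PoissonLin.complexEigenvalues (c.blockS H) + Multiset.replicate r 0 := by
      rw [(hblock n r c).1, (hblock n r c).2, PoissonLin.complexEigenvalues_fromBlocks_zero,
        Fintype.card_fin]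
    refine ⟨h, fun lam => ?_⟩
    rw [c.hasEigenvalue_iff, h, Multiset.mem_add, Multiset.mem_replicate, and_comm,
      Nat.pos_iff_ne_zero]
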